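/- Conventions. A left bialgebroid $\mathcal A_L=(A,L,s_L,t_L,\gamma_L,\pi_L)$ consists of rings $A,L$, ring homomorphisms $s_L:L\to A$, $t_L:L^{op}\to A$ with commuting images, and a coproduct $\gamma_L(a)=a_{(1)}\otimes a_{(2)}$ and a counit $\pi_L$ making $A$, with $l\cdot a\cdot l'=s_L(l)t_L(l')a$, a comonoid in $L$-$L$-bimodules, such that $a_{(1)}t_L(l)\otimes a_{(2)}=a_{(1)}\otimes a_{(2)}s_L(l)$, $\gamma_L$ is unital and multiplicative, $\pi_L(1)=1$ and $\pi_L(a\,s_L\pi_L(b))=\pi_L(ab)=\pi_L(a\,t_L\pi_L(b))$. A right bialgebroid $\mathcal A_R=(A,R,s_R,t_R,\gamma_R,\pi_R)$, $\gamma_R(a)=a^{(1)}\otimes a^{(2)}$, is defined in the same way by the opposite axioms, with $r\cdot a\cdot r'=a\,s_R(r')t_R(r)$. A Hopf algebroid $\mathcal A=(\mathcal A_L,\mathcal A_R,S)$ consists of a left and a right bialgebroid on the same ring $A$ with $R\simeq L^{op}$, $s_L(L)=t_R(R)$, $t_L(L)=s_R(R)$, $(\gamma_L\otimes\mathrm{id})\gamma_R=(\mathrm{id}\otimes\gamma_R)\gamma_L$,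 $(\gamma_R\otimes\mathrm{id})\gamma_L=(\mathrm{id}\otimes\gamma_L)\gamma_R$, and an additive bijection $S:A\to A$ with $S(t_L(l)a\,t_L(l'))=s_L(l')S(a)s_L(l)$, $S(t_R(r')a\,t_R(r))=s_R(r)S(a)s_R(r')$, $S(a_{(1)})a_{(2)}=s_R\pi_R(a)$ and $a^{(1)}S(a^{(2)})=s_L\pi_L(a)$. Let $\mathcal A_*$ be the set of additive maps $\phi:A\to L$ with $\phi(t_L(l)a)=\phi(a)l$, put $a\leftharpoonup\phi=s_L(\phi(a_{(1)}))a_{(2)}$, and make $\mathcal A_*$ a ring with product $(\phi\psi)(a)=\psi(a\leftharpoonup\phi)$ and unit $\pi_L$. A twist of $(\mathcal A_L,S)$ is an invertible $g\in\mathcal A_*$ with $1\leftharpoonup g=1$, $(a\leftharpoonup g)(b\leftharpoonup g)=ab\leftharpoonup g$ and $(S(a_{(1)})\leftharpoonup g)\otimes a_{(2)}=S(a_{(1)})\otimes(a_{(2)}\leftharpoonup g^{-1})$, the last identity in the tensor product over $L$ of $A$ with the right action $a\cdot l=a\,s_L(l)$ and $A$ with the left action $l\cdot a=s_L(g^{-1}(s_L(l)))a$.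 The twisted antipode is $S_g(a)=S(a\leftharpoonup g)$. Theorem. Let $k$ be a commutative ring and $\mathcal A=(\mathcal A_L,\mathcal A_R,S)$ a Hopf algebroid such that $A$ and $L$ are $k$-algebras and $s_L,t_L$ are $k$-algebra homomorphisms. Let $(L,k,\delta,\psi)$ be a separability structure on $L$: $\delta:L\to L\otimes_kL$ is a $k$-linear coassociative coproduct with $k$-linear counit $\psi:L\to k$, such that $(\mathrm{id}\otimes m_L)(\delta\otimes\mathrm{id})=\delta\circ m_L=(m_L\otimes\mathrm{id})(\mathrm{id}\otimes\delta)$ and $m_L\circ\delta=\mathrm{id}_L$. Write $\delta(1_L)=\sum_ie_i\otimes f_i$ and put $$\Delta(a)=\sum_i t_L(e_i)a_{(1)}\otimes s_L(f_i)a_{(2)}\in A\otimes_kA,\qquad \varepsilon=\psi\circ\pi_L.$$ Then $(A,\Delta,\varepsilon)$ is a weak bialgebra over $k$, and: (1) $(A,\Delta,\varepsilon,S)$ is a weak Hopf algebra if and only if $\psi\circ\pi_L\circ S=\psi\circ\pi_L$. (2) There is a twist $g$ of $(\mathcal A_L,S)$ such that $(A,\Delta,\varepsilon,S_g)$ is a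 weak Hopf algebra if and only if $\psi\circ\pi_L\circ S$ is invertible in the convolution algebra $\hat A=\mathrm{Hom}_k(A,k)$, with product $\phi\phi'=(\phi\otimes\phi')\circ\Delta$ and unit $\varepsilon$. -/

import Mathlib

open scoped TensorProduct
open MulOpposite

namespace HopfAlgd

/-! ## Tensor products over a noncommutative base ring

`ρ` is a right action and `lam` a left action of `L` on the abelian group `A`. -/

section AdditiveMaps

variable {M N P : Type*} [AddCommGroup M] [AddCommGroup N] [AddCommGroup P]

/-- The biadditive map `(m, n) ↦ m ⊗ n`. -/
def tmulHom (M N : Type*) [AddCommGroup M] [AddCommGroup N] : M →+ N →+ M ⊗[ℤ] N :=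
  AddMonoidHom.mk' (fun m => AddMonoidHom.mk' (fun n => m ⊗ₜ[ℤ] n) (TensorProduct.tmul_add m))
    (fun m m' => AddMonoidHom.ext (TensorProduct.add_tmul m m'))

@[simp] theorem tmulHom_apply (m : M) (n : N) : tmulHom M N m n = m ⊗ₜ[ℤ] n := rfl

/-- The additive map on the tensor product induced by a biadditive map. -/
def liftAdd (f : M →+ N →+ P) : M ⊗[ℤ] N →+ P :=
  TensorProduct.liftAddHom f (fun r m n => by simp)

@[simp] theorem liftAdd_tmul (f : M →+ N →+ P) (m : M) (n : N) :
    liftAdd f (m ⊗ₜ[ℤ] n) = f m n := rfl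

end AdditiveMaps

section Balanced

variable {A L R : Type*} [Ring A]

/-- The relations `a · l ⊗ b = a ⊗ l · b` in `A ⊗ A`. -/
def balRel (ρ lam : L → A → A) : AddSubgroup (A ⊗[ℤ] A) :=
  AddSubgroup.closure {x | ∃ (l : L) (a b : A), x = ρ l a ⊗ₜ[ℤ] b - a ⊗ₜ[ℤ] lam l b}

/-- The tensor product of `A` (right action `ρ`) and `A` (left action `lam`) over `L`. -/
abbrev Bal (ρ lam : L → A → A) : Type _ := (A ⊗[ℤ] A) ⧸ balRel ρ lam

/-- The class in `Bal ρ lam` of an element of `A ⊗ A`. -/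
def Bal.mk (ρ lam : L → A → A) : A ⊗[ℤ] A →+ Bal ρ lam := QuotientAddGroup.mk' (balRel ρ lam)

theorem Bal.mk_surjective (ρ lam : L → A → A) : Function.Surjective (Bal.mk ρ lam) :=
  QuotientAddGroup.mk'_surjective _

/-- The additive map on `Bal ρ lam` induced by a balanced biadditive map. -/
def Bal.lift {P : Type*} [AddCommGroup P] (ρ lam : L → A → A) (f : A ⊗[ℤ] A →+ P)
    (hf : ∀ (l : L) (a b : A), f (ρ l a ⊗ₜ[ℤ] b) = f (a ⊗ₜ[ℤ] lam l b)) : Bal ρ lam →+ P :=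
  QuotientAddGroup.lift (balRel ρ lam) f ((AddSubgroup.closure_le (f.ker)).2 (by
    rintro _ ⟨l, a, b, rfl⟩
    change f _ = 0
    rw [map_sub, hf, sub_self]))

@[simp] theorem Bal.lift_mk {P : Type*} [AddCommGroup P] (ρ lam : L → A → A) (f : A ⊗[ℤ] A →+ P)
    (hf : ∀ (l : L) (a b : A), f (ρ l a ⊗ₜ[ℤ] b) = f (a ⊗ₜ[ℤ] lam l b)) (x : A ⊗[ℤ] A) :
    Bal.lift ρ lam f hf (Bal.mk ρ lam x) = f x := rfl

/-- The relations of the threefold tensor product of `A`, balanced over `L` in the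
first place and over `R` in the second place. -/
def balRel₃ (ρ₁ lam₁ : L → A → A) (ρ₂ lam₂ : R → A → A) : AddSubgroup (A ⊗[ℤ] (A ⊗[ℤ] A)) :=
  AddSubgroup.closure
    ({x | ∃ (l : L) (a b c : A),
        x = ρ₁ l a ⊗ₜ[ℤ] (b ⊗ₜ[ℤ] c) - a ⊗ₜ[ℤ] (lam₁ l b ⊗ₜ[ℤ] c)} ∪
     {x | ∃ (r : R) (a b c : A),
        x = a ⊗ₜ[ℤ] (ρ₂ r b ⊗ₜ[ℤ] c) - a ⊗ₜ[ℤ] (b ⊗ₜ[ℤ] lam₂ r c)})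

/-- The threefold tensor product of `A` over `L` and `R`. -/
abbrev Bal₃ (ρ₁ lam₁ : L → A → A) (ρ₂ lam₂ : R → A → A) : Type _ :=
  (A ⊗[ℤ] (A ⊗[ℤ] A)) ⧸ balRel₃ ρ₁ lam₁ ρ₂ lam₂

variable (ρ₁ lam₁ : L → A → A) (ρ₂ lam₂ : R → A → A)

/-- The class in `Bal₃ ρ₁ lam₁ ρ₂ lam₂` of an element of `A ⊗ (A ⊗ A)`. -/
def Bal₃.mk : A ⊗[ℤ] (A ⊗[ℤ] A) →+ Bal₃ ρ₁ lam₁ ρ₂ lam₂ :=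
  QuotientAddGroup.mk' (balRel₃ ρ₁ lam₁ ρ₂ lam₂)

theorem Bal₃.mk_rel_left (l : L) (a b c : A) :
    Bal₃.mk ρ₁ lam₁ ρ₂ lam₂ (ρ₁ l a ⊗ₜ[ℤ] (b ⊗ₜ[ℤ] c)) =
      Bal₃.mk ρ₁ lam₁ ρ₂ lam₂ (a ⊗ₜ[ℤ] (lam₁ l b ⊗ₜ[ℤ] c)) := by
  rw [← sub_eq_zero, ← map_sub]
  exact (QuotientAddGroup.eq_zero_iff _).2
    (AddSubgroup.subset_closure (Or.inl ⟨l, a, b, c, rfl⟩))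

theorem Bal₃.mk_rel_right (r : R) (a b c : A) :
    Bal₃.mk ρ₁ lam₁ ρ₂ lam₂ (a ⊗ₜ[ℤ] (ρ₂ r b ⊗ₜ[ℤ] c)) =
      Bal₃.mk ρ₁ lam₁ ρ₂ lam₂ (a ⊗ₜ[ℤ] (b ⊗ₜ[ℤ] lam₂ r c)) := by
  rw [← sub_eq_zero, ← map_sub]
  exact (QuotientAddGroup.eq_zero_iff _).2
    (AddSubgroup.subset_closure (Or.inr ⟨r, a, b, c, rfl⟩))

/-- The canonical map `(A ⊗_L A) ⊗ A → A ⊗_L A ⊗_R A`, `((a ⊗ b), c) ↦ a ⊗ b ⊗ c`. -/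
def joinLeft : Bal ρ₁ lam₁ →+ A →+ Bal₃ ρ₁ lam₁ ρ₂ lam₂ :=
  Bal.lift ρ₁ lam₁
    (liftAdd (AddMonoidHom.mk'
      (fun a => AddMonoidHom.mk'
        (fun b => ((Bal₃.mk ρ₁ lam₁ ρ₂ lam₂).comp (tmulHom A (A ⊗[ℤ] A) a)).comp (tmulHom A A b))
        (fun b b' => AddMonoidHom.ext fun c => by simp [TensorProduct.tmul_add]))
      (fun a a' => AddMonoidHom.ext fun b => AddMonoidHom.ext fun c => by simp)))
    (fun l a b => AddMonoidHom.ext fun c => Bal₃.mk_rel_left ρ₁ lam₁ ρ₂ lam₂ l a b c)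

/-- The canonical map `A ⊗ (A ⊗_R A) → A ⊗_L A ⊗_R A`, `((b ⊗ c), a) ↦ a ⊗ b ⊗ c`. -/
def joinRight : Bal ρ₂ lam₂ →+ A →+ Bal₃ ρ₁ lam₁ ρ₂ lam₂ :=
  Bal.lift ρ₂ lam₂
    ((AddMonoidHom.compHom (Bal₃.mk ρ₁ lam₁ ρ₂ lam₂)).comp (tmulHom A (A ⊗[ℤ] A)).flip)
    (fun r b c => AddMonoidHom.ext fun a => Bal₃.mk_rel_right ρ₁ lam₁ ρ₂ lam₂ r a b c)

@[simp] theorem joinLeft_mk (a b c : A) :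
    joinLeft ρ₁ lam₁ ρ₂ lam₂ (Bal.mk ρ₁ lam₁ (a ⊗ₜ[ℤ] b)) c =
      Bal₃.mk ρ₁ lam₁ ρ₂ lam₂ (a ⊗ₜ[ℤ] (b ⊗ₜ[ℤ] c)) := rfl

@[simp] theorem joinRight_mk (a b c : A) :
    joinRight ρ₁ lam₁ ρ₂ lam₂ (Bal.mk ρ₂ lam₂ (b ⊗ₜ[ℤ] c)) a =
      Bal₃.mk ρ₁ lam₁ ρ₂ lam₂ (a ⊗ₜ[ℤ] (b ⊗ₜ[ℤ] c)) := rfl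

/-- `γ ⊗ id` on representatives: `a ⊗ b ↦ γ(a) ⊗ b`. -/
def coLeft (γ : A →+ Bal ρ₁ lam₁) : A ⊗[ℤ] A →+ Bal₃ ρ₁ lam₁ ρ₂ lam₂ :=
  liftAdd ((joinLeft ρ₁ lam₁ ρ₂ lam₂).comp γ)

/-- `id ⊗ γ` on representatives: `a ⊗ b ↦ a ⊗ γ(b)`. -/
def coRight (γ : A →+ Bal ρ₂ lam₂) : A ⊗[ℤ] A →+ Bal₃ ρ₁ lam₁ ρ₂ lam₂ :=
  liftAdd ((joinRight ρ₁ lam₁ ρ₂ lam₂).comp γ).flip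

@[simp] theorem coLeft_tmul (γ : A →+ Bal ρ₁ lam₁) (a b : A) :
    coLeft ρ₁ lam₁ ρ₂ lam₂ γ (a ⊗ₜ[ℤ] b) = joinLeft ρ₁ lam₁ ρ₂ lam₂ (γ a) b := rfl

@[simp] theorem coRight_tmul (γ : A →+ Bal ρ₂ lam₂) (a b : A) :
    coRight ρ₁ lam₁ ρ₂ lam₂ γ (a ⊗ₜ[ℤ] b) = joinRight ρ₁ lam₁ ρ₂ lam₂ (γ b) a := rfl

/-- The additive map `a ⊗ b ↦ f(a) ⊗ g(b)`. -/
def mapTensor (f g : A →+ A) : A ⊗[ℤ] A →+ A ⊗[ℤ] A :=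
  liftAdd (((tmulHom A A).comp f).compl₂ g)

@[simp] theorem mapTensor_tmul (f g : A →+ A) (a b : A) :
    mapTensor f g (a ⊗ₜ[ℤ] b) = f a ⊗ₜ[ℤ] g b := rfl

/-- The additive map `a ⊗ b ↦ f(a) g(b)`. -/
def mulMap (f g : A →+ A) : A ⊗[ℤ] A →+ A :=
  liftAdd ((AddMonoidHom.mul.comp f).compl₂ g)

@[simp] theorem mulMap_tmul (f g : A →+ A) (a b : A) :
    mulMap f g (a ⊗ₜ[ℤ] b) = f a * g b := rfl

/-- The additive map `a ⊗ b ↦ g(b) f(a)`. -/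
def mulMapOp (f g : A →+ A) : A ⊗[ℤ] A →+ A :=
  liftAdd ((AddMonoidHom.mul.flip.comp f).compl₂ g)

@[simp] theorem mulMapOp_tmul (f g : A →+ A) (a b : A) :
    mulMapOp f g (a ⊗ₜ[ℤ] b) = g b * f a := rfl

end Balanced

/-! ## Bialgebroids

An identity between Sweedler expressions in `γ(a) = a₁ ⊗ a₂` is stated for every representative
`x ∈ A ⊗ A` of `γ(a)`. Each expression that occurs is independent of the representative
thanks to the axioms that come before it. -/

/-- A left bialgebroid with total ring `A` and base ring `L`.
`s` and `t` are the source and the target map, `γ` is the coproduct into the tensor product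
of `A` (with `a · l = t(l) a`) and `A` (with `l · a = s(l) a`), and `π` is the counit. -/
structure LeftBialgebroid (A L : Type*) [Ring A] [Ring L] where
  s : L →+* A
  t : Lᵐᵒᵖ →+* A
  s_mul_t : ∀ l l' : L, s l * t (op l') = t (op l') * s l
  γ : A →+ Bal (fun (l : L) (a : A) => t (op l) * a) (fun (l : L) (a : A) => s l * a)
  π : A →+ L
  γ_bimodule : ∀ (l l' : L) (a : A) (x : A ⊗[ℤ] A), Bal.mk _ _ x = γ a →
    γ (s l * t (op l') * a) = Bal.mk _ _ ((s l ⊗ₜ[ℤ] t (op l')) * x)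
  π_bimodule : ∀ (l l' : L) (a : A), π (s l * t (op l') * a) = l * π a * l'
  coassoc : ∀ (a : A) (x : A ⊗[ℤ] A), Bal.mk _ _ x = γ a →
    coLeft _ _ _ _ γ x = coRight _ _ _ _ γ x
  counit_left : ∀ (a : A) (x : A ⊗[ℤ] A), Bal.mk _ _ x = γ a →
    mulMap (s.toAddMonoidHom.comp π) (AddMonoidHom.id A) x = a
  counit_right : ∀ (a : A) (x : A ⊗[ℤ] A), Bal.mk _ _ x = γ a →
    mulMapOp (AddMonoidHom.id A)
      (t.toAddMonoidHom.comp ((opAddEquiv : L ≃+ Lᵐᵒᵖ).toAddMonoidHom.comp π)) x = a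
  takeuchi : ∀ (l : L) (a : A) (x : A ⊗[ℤ] A), Bal.mk _ _ x = γ a →
    Bal.mk (fun (l : L) (a : A) => t (op l) * a) (fun (l : L) (a : A) => s l * a)
        (x * (t (op l) ⊗ₜ[ℤ] 1)) =
      Bal.mk _ _ (x * (1 ⊗ₜ[ℤ] s l))
  γ_one : γ 1 = Bal.mk _ _ (1 ⊗ₜ[ℤ] 1)
  γ_mul : ∀ (a b : A) (x y : A ⊗[ℤ] A), Bal.mk _ _ x = γ a → Bal.mk _ _ y = γ b →
    γ (a * b) = Bal.mk _ _ (x * y)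
  π_one : π 1 = 1
  π_mul_s : ∀ a b : A, π (a * s (π b)) = π (a * b)
  π_mul_t : ∀ a b : A, π (a * t (op (π b))) = π (a * b)

/-- A right bialgebroid with total ring `A` and base ring `R`. The coproduct takes values in
the tensor product of `A` (with `a · r = a s(r)`) and `A` (with `r · a = a t(r)`). -/
structure RightBialgebroid (A R : Type*) [Ring A] [Ring R] where
  s : R →+* A
  t : Rᵐᵒᵖ →+* A
  s_mul_t : ∀ r r' : R, s r * t (op r') = t (op r') * s r
  γ : A →+ Bal (fun (r : R) (a : A) => a * s r) (fun (r : R) (a : A) => a * t (op r))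
  π : A →+ R
  γ_bimodule : ∀ (r r' : R) (a : A) (x : A ⊗[ℤ] A), Bal.mk _ _ x = γ a →
    γ (a * s r' * t (op r)) = Bal.mk _ _ (x * (t (op r) ⊗ₜ[ℤ] s r'))
  π_bimodule : ∀ (r r' : R) (a : A), π (a * s r' * t (op r)) = r * π a * r'
  coassoc : ∀ (a : A) (x : A ⊗[ℤ] A), Bal.mk _ _ x = γ a →
    coLeft _ _ _ _ γ x = coRight _ _ _ _ γ x
  counit_left : ∀ (a : A) (x : A ⊗[ℤ] A), Bal.mk _ _ x = γ a →
    mulMapOp (t.toAddMonoidHom.comp ((opAddEquiv : R ≃+ Rᵐᵒᵖ).toAddMonoidHom.comp π))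
      (AddMonoidHom.id A) x = a
  counit_right : ∀ (a : A) (x : A ⊗[ℤ] A), Bal.mk _ _ x = γ a →
    mulMap (AddMonoidHom.id A) (s.toAddMonoidHom.comp π) x = a
  takeuchi : ∀ (r : R) (a : A) (x : A ⊗[ℤ] A), Bal.mk _ _ x = γ a →
    Bal.mk (fun (r : R) (a : A) => a * s r) (fun (r : R) (a : A) => a * t (op r))
        ((s r ⊗ₜ[ℤ] 1) * x) =
      Bal.mk _ _ ((1 ⊗ₜ[ℤ] t (op r)) * x)
  γ_one : γ 1 = Bal.mk _ _ (1 ⊗ₜ[ℤ] 1)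
  γ_mul : ∀ (a b : A) (x y : A ⊗[ℤ] A), Bal.mk _ _ x = γ a → Bal.mk _ _ y = γ b →
    γ (a * b) = Bal.mk _ _ (x * y)
  π_one : π 1 = 1
  π_s_mul : ∀ a b : A, π (s (π a) * b) = π (a * b)
  π_t_mul : ∀ a b : A, π (t (op (π a)) * b) = π (a * b)

/-! ## Hopf algebroids -/

/-- A Hopf algebroid: a left and a right bialgebroid on the same total ring and an antipode. -/
structure HopfAlgebroid (A L R : Type*) [Ring A] [Ring L] [Ring R] where
  left : LeftBialgebroid A L
  right : RightBialgebroid A R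
  base_anti : Nonempty (R ≃+* Lᵐᵒᵖ)
  range_s : Set.range left.s = Set.range right.t
  range_t : Set.range left.t = Set.range right.s
  /-- `(γ_L ⊗ id) ∘ γ_R = (id ⊗ γ_R) ∘ γ_L` -/
  coassoc_left_right : ∀ (a : A) (x y : A ⊗[ℤ] A),
    Bal.mk _ _ x = right.γ a → Bal.mk _ _ y = left.γ a →
    coLeft _ _ _ _ left.γ x = coRight _ _ _ _ right.γ y
  /-- `(γ_R ⊗ id) ∘ γ_L = (id ⊗ γ_L) ∘ γ_R` -/
  coassoc_right_left : ∀ (a : A) (x y : A ⊗[ℤ] A),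
    Bal.mk _ _ x = left.γ a → Bal.mk _ _ y = right.γ a →
    coLeft _ _ _ _ right.γ x = coRight _ _ _ _ left.γ y
  S : A ≃+ A
  S_left : ∀ (l l' : L) (a : A),
    S (left.t (op l) * a * left.t (op l')) = left.s l' * S a * left.s l
  S_right : ∀ (r r' : R) (a : A),
    S (right.t (op r') * a * right.t (op r)) = right.s r * S a * right.s r'
  /-- `S(a₍₁₎) a₍₂₎ = s_R(π_R(a))` -/
  antipode_left : ∀ (a : A) (x : A ⊗[ℤ] A), Bal.mk _ _ x = left.γ a →
    mulMap S.toAddMonoidHom (AddMonoidHom.id A) x = right.s (right.π a)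
  /-- `a⁽¹⁾ S(a⁽²⁾) = s_L(π_L(a))` -/
  antipode_right : ∀ (a : A) (x : A ⊗[ℤ] A), Bal.mk _ _ x = right.γ a →
    mulMap (AddMonoidHom.id A) S.toAddMonoidHom x = left.s (left.π a)

/-! ## The dual ring of a left bialgebroid and twists -/

namespace LeftBialgebroid

variable {A L : Type*} [Ring A] [Ring L] (B : LeftBialgebroid A L)

/-- The right `L`-linear maps `A_L → L_L`, where `A_L` has the action `a · l = t(l) a`. -/
structure Dual where
  toHom : A →+ L
  map_t_mul : ∀ (l : L) (a : A), toHom (B.t (op l) * a) = toHom a * l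

/-- The map `a ⊗ b ↦ s(φ(a)) b` on the tensor product over `L`. -/
def actAux (φ : B.Dual) :
    Bal (fun (l : L) (a : A) => B.t (op l) * a) (fun (l : L) (a : A) => B.s l * a) →+ A :=
  Bal.lift _ _ (mulMap (B.s.toAddMonoidHom.comp φ.toHom) (AddMonoidHom.id A)) (fun l a b => by
    simp [φ.map_t_mul, mul_assoc])

/-- The right action `a ↼ φ = s(φ(a₁)) a₂` of the dual on `A`. -/
def act (φ : B.Dual) : A →+ A := (B.actAux φ).comp B.γ

theorem γ_t_mul (l : L) (a : A) (x : A ⊗[ℤ] A) (hx : Bal.mk _ _ x = B.γ a) :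
    B.γ (B.t (op l) * a) = Bal.mk _ _ ((1 ⊗ₜ[ℤ] B.t (op l)) * x) := by
  simpa using B.γ_bimodule 1 l a x hx

theorem γ_s_mul (l : L) (a : A) (x : A ⊗[ℤ] A) (hx : Bal.mk _ _ x = B.γ a) :
    B.γ (B.s l * a) = Bal.mk _ _ ((B.s l ⊗ₜ[ℤ] 1) * x) := by
  simpa using B.γ_bimodule l 1 a x hx

theorem exists_rep (a : A) : ∃ x : A ⊗[ℤ] A, Bal.mk _ _ x = B.γ a :=
  Bal.mk_surjective _ _ (B.γ a)

theorem act_t_mul (φ : B.Dual) (l : L) (a : A) :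
    B.act φ (B.t (op l) * a) = B.t (op l) * B.act φ a := by
  obtain ⟨x, hx⟩ := B.exists_rep a
  have key : ∀ y : A ⊗[ℤ] A,
      mulMap (B.s.toAddMonoidHom.comp φ.toHom) (AddMonoidHom.id A) ((1 ⊗ₜ[ℤ] B.t (op l)) * y) =
        B.t (op l) * mulMap (B.s.toAddMonoidHom.comp φ.toHom) (AddMonoidHom.id A) y := by
    intro y
    induction y with
    | zero => simp
    | tmul a b =>
      simp only [mulMap_tmul, Algebra.TensorProduct.tmul_mul_tmul, one_mul,
        AddMonoidHom.comp_apply, AddMonoidHom.id_apply,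
        RingHom.toAddMonoidHom_eq_coe, AddMonoidHom.coe_coe]
      rw [← mul_assoc, ← mul_assoc, B.s_mul_t]
    | add y z hy hz => rw [mul_add, map_add, map_add, hy, hz, mul_add]
  change B.actAux φ (B.γ _) = _ * B.actAux φ (B.γ a)
  rw [B.γ_t_mul l a x hx, ← hx]
  exact key x

/-- The product `(φ ψ)(a) = ψ(s(φ(a₁)) a₂)` of the dual ring. -/
def Dual.mul (φ ψ : B.Dual) : B.Dual where
  toHom := ψ.toHom.comp (B.act φ)
  map_t_mul l a := by
    simp only [AddMonoidHom.comp_apply, B.act_t_mul, ψ.map_t_mul]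

/-- The unit of the dual ring is the counit of the bialgebroid. -/
def Dual.one : B.Dual where
  toHom := B.π
  map_t_mul l a := by simpa using B.π_bimodule 1 l a

/-- A twist of `(B, S)`: an invertible element `g` of the dual ring, with inverse `inv`, such that
`1 ↼ g = 1`, `(a ↼ g)(b ↼ g) = ab ↼ g` and
`(S(a₁) ↼ g) ⊗ a₂ = S(a₁) ⊗ (a₂ ↼ g⁻¹)` in the tensor product over `L` of `A` with the right
action `a · l = a s(l)` and `A` with the left action `l · a = s(g⁻¹(s(l))) a`. -/
structure Twist (S : A ≃+ A) where
  g : B.Dual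
  inv : B.Dual
  mul_inv : Dual.mul B g inv = Dual.one B
  inv_mul : Dual.mul B inv g = Dual.one B
  one_act : B.act g 1 = 1
  act_mul : ∀ a b : A, B.act g a * B.act g b = B.act g (a * b)
  antipode_act : ∀ (a : A) (x : A ⊗[ℤ] A), Bal.mk _ _ x = B.γ a →
    Bal.mk (fun (l : L) (a : A) => a * B.s l)
        (fun (l : L) (a : A) => B.s (inv.toHom (B.s l)) * a)
        (mapTensor ((B.act g).comp S.toAddMonoidHom) (AddMonoidHom.id A) x) =
      Bal.mk _ _ (mapTensor S.toAddMonoidHom (B.act inv) x)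

/-- The bialgebroid is one of `k`-algebras: `s` and `t` respect the `k`-algebra structures. -/
structure IsOver (k : Type*) [CommRing k] [Algebra k A] [Algebra k L] : Prop where
  s_algebraMap : ∀ c : k, B.s (algebraMap k L c) = algebraMap k A c
  t_algebraMap : ∀ c : k, B.t (op (algebraMap k L c)) = algebraMap k A c

end LeftBialgebroid

/-! ## Separability structures and weak Hopf algebras -/

/-- A separability structure `(L, k, δ, ψ)` on a `k`-algebra `L`. -/
structure SeparabilityStructure (k L : Type*) [CommRing k] [Ring L] [Algebra k L] where
  δ : L →ₗ[k] L ⊗[k] L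
  ψ : L →ₗ[k] k
  coassoc : (TensorProduct.assoc k L L L).toLinearMap ∘ₗ δ.rTensor L ∘ₗ δ = δ.lTensor L ∘ₗ δ
  counit_left : ∀ l : L, TensorProduct.lid k L (ψ.rTensor L (δ l)) = l
  counit_right : ∀ l : L, TensorProduct.rid k L (ψ.lTensor L (δ l)) = l
  /-- `(id ⊗ m) ∘ (δ ⊗ id) = δ ∘ m` -/
  frobenius_left : (LinearMap.mul' k L).lTensor L ∘ₗ (TensorProduct.assoc k L L L).toLinearMap ∘ₗ
    δ.rTensor L = δ ∘ₗ LinearMap.mul' k L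
  /-- `(m ⊗ id) ∘ (id ⊗ δ) = δ ∘ m` -/
  frobenius_right : (LinearMap.mul' k L).rTensor L ∘ₗ
    (TensorProduct.assoc k L L L).symm.toLinearMap ∘ₗ δ.lTensor L = δ ∘ₗ LinearMap.mul' k L
  mul_δ : LinearMap.mul' k L ∘ₗ δ = LinearMap.id

section Weak

variable {k A : Type*} [CommRing k] [Ring A] [Algebra k A]

/-- `(A, Δ, ε)` is a weak bialgebra over `k`. -/
structure IsWeakBialgebra (Δ : A →ₗ[k] A ⊗[k] A) (ε : A →ₗ[k] k) : Prop where
  coassoc : (TensorProduct.assoc k A A A).toLinearMap ∘ₗ Δ.rTensor A ∘ₗ Δ = Δ.lTensor A ∘ₗ Δ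
  counit_left : ∀ a : A, TensorProduct.lid k A (ε.rTensor A (Δ a)) = a
  counit_right : ∀ a : A, TensorProduct.rid k A (ε.lTensor A (Δ a)) = a
  comul_mul : ∀ a b : A, Δ (a * b) = Δ a * Δ b
  /-- `(Δ(1) ⊗ 1)(1 ⊗ Δ(1)) = (Δ ⊗ id)(Δ(1))` -/
  comul_one_left : (Δ 1 ⊗ₜ[k] (1 : A)) * (TensorProduct.assoc k A A A).symm (1 ⊗ₜ[k] Δ 1) =
    Δ.rTensor A (Δ 1)
  /-- `(1 ⊗ Δ(1))(Δ(1) ⊗ 1) = (Δ ⊗ id)(Δ(1))` -/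
  comul_one_right : (TensorProduct.assoc k A A A).symm (1 ⊗ₜ[k] Δ 1) * (Δ 1 ⊗ₜ[k] (1 : A)) =
    Δ.rTensor A (Δ 1)
  /-- `ε(abc) = ε(ab₁) ε(b₂c)` -/
  counit_mul_left : ∀ a b c : A, ε (a * b * c) = LinearMap.mul' k k
    (TensorProduct.map (ε ∘ₗ LinearMap.mulLeft k a) (ε ∘ₗ LinearMap.mulRight k c) (Δ b))
  /-- `ε(abc) = ε(ab₂) ε(b₁c)` -/
  counit_mul_right : ∀ a b c : A, ε (a * b * c) = LinearMap.mul' k k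
    (TensorProduct.map (ε ∘ₗ LinearMap.mulRight k c) (ε ∘ₗ LinearMap.mulLeft k a) (Δ b))

/-- `(A, Δ, ε, S)` is a weak Hopf algebra over `k`. -/
structure IsWeakHopfAlgebra (Δ : A →ₗ[k] A ⊗[k] A) (ε : A →ₗ[k] k) (S : A →ₗ[k] A) : Prop
    extends IsWeakBialgebra Δ ε where
  /-- `a₁ S(a₂) = ε(1₁ a) 1₂` -/
  mul_antipode : ∀ a : A, LinearMap.mul' k A (S.lTensor A (Δ a)) =
    TensorProduct.lid k A ((ε ∘ₗ LinearMap.mulRight k a).rTensor A (Δ 1))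
  /-- `S(a₁) a₂ = 1₁ ε(a 1₂)` -/
  antipode_mul : ∀ a : A, LinearMap.mul' k A (S.rTensor A (Δ a)) =
    TensorProduct.rid k A ((ε ∘ₗ LinearMap.mulLeft k a).lTensor A (Δ 1))
  /-- `S(a₁) a₂ S(a₃) = S(a)` -/
  antipode_mul_antipode : ∀ a : A, LinearMap.mul' k A
    (TensorProduct.map (LinearMap.mul' k A ∘ₗ S.rTensor A) S (Δ.rTensor A (Δ a))) = S a

/-- The convolution product `(φ ⊗ φ') ∘ Δ` of linear functionals. -/
def convMul (Δ : A →ₗ[k] A ⊗[k] A) (φ φ' : A →ₗ[k] k) : A →ₗ[k] k :=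
  LinearMap.mul' k k ∘ₗ TensorProduct.map φ φ' ∘ₗ Δ

/-- `φ` is invertible in the convolution algebra of linear functionals, with unit `ε`. -/
def IsConvInvertible (Δ : A →ₗ[k] A ⊗[k] A) (ε φ : A →ₗ[k] k) : Prop :=
  ∃ φ' : A →ₗ[k] k, convMul Δ φ φ' = ε ∧ convMul Δ φ' φ = ε

end Weak

/-! ## The weak bialgebra of a bialgebroid over a separable base -/

namespace LeftBialgebroid

variable {k A L : Type*} [CommRing k] [Ring A] [Ring L] [Algebra k A] [Algebra k L]
  (B : LeftBialgebroid A L)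

variable {B} in
theorem IsOver.smul_eq_s (hk : B.IsOver k) (c : k) (a : A) :
    c • a = B.s (algebraMap k L c) * a := by
  rw [hk.s_algebraMap, Algebra.smul_def]

variable {B} in
theorem IsOver.smul_eq_t (hk : B.IsOver k) (c : k) (a : A) :
    c • a = B.t (op (algebraMap k L c)) * a := by
  rw [hk.t_algebraMap, Algebra.smul_def]

/-- The source map as a `k`-linear map. -/
def sLin (hk : B.IsOver k) : L →ₗ[k] A where
  toFun := B.s
  map_add' := map_add _
  map_smul' c l := by
    rw [Algebra.smul_def, map_mul, hk.s_algebraMap, RingHom.id_apply, Algebra.smul_def]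

/-- The target map as a `k`-linear map. -/
def tLin (hk : B.IsOver k) : L →ₗ[k] A where
  toFun l := B.t (op l)
  map_add' l l' := by rw [op_add, map_add]
  map_smul' c l := by
    rw [Algebra.smul_def, Algebra.commutes, op_mul, map_mul, hk.t_algebraMap, RingHom.id_apply,
      Algebra.smul_def]

/-- The counit as a `k`-linear map. -/
def πLin (hk : B.IsOver k) : A →ₗ[k] L where
  toFun := B.π
  map_add' := map_add _
  map_smul' c a := by
    have h := B.π_bimodule (algebraMap k L c) 1 a
    rw [op_one, map_one, mul_one, mul_one] at h
    rw [hk.smul_eq_s, h, RingHom.id_apply, Algebra.smul_def]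

/-- An element `φ` of the dual ring is `k`-linear as a map `a ↦ a ↼ φ`. -/
def actLin (hk : B.IsOver k) (φ : B.Dual) : A →ₗ[k] A where
  toFun := B.act φ
  map_add' := map_add _
  map_smul' c a := by
    rw [hk.smul_eq_t, B.act_t_mul, RingHom.id_apply, ← hk.smul_eq_t]

/-- `t(eᵢ) ⊗ s(fᵢ)`, where `δ(1) = eᵢ ⊗ fᵢ`. -/
def sepElem (hk : B.IsOver k) (σ : SeparabilityStructure k L) : A ⊗[k] A :=
  TensorProduct.map (B.tLin hk) (B.sLin hk) (σ.δ 1)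

theorem sepElem_mul (hk : B.IsOver k) (σ : SeparabilityStructure k L) (l : L) :
    B.sepElem hk σ * (B.t (op l) ⊗ₜ[k] 1) = B.sepElem hk σ * (1 ⊗ₜ[k] B.s l) := by
  have h1 : ∀ y : L ⊗[k] L,
      TensorProduct.map (B.tLin hk) (B.sLin hk) y * (B.t (op l) ⊗ₜ[k] 1) =
        TensorProduct.map (B.tLin hk) (B.sLin hk) ((l ⊗ₜ[k] 1) * y) := by
    intro y
    induction y with
    | zero => simp
    | tmul a b => simp [tLin, sLin]
    | add y z hy hz => rw [map_add, add_mul, hy, hz, mul_add, map_add]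
  have h2 : ∀ y : L ⊗[k] L,
      TensorProduct.map (B.tLin hk) (B.sLin hk) y * (1 ⊗ₜ[k] B.s l) =
        TensorProduct.map (B.tLin hk) (B.sLin hk) (y * (1 ⊗ₜ[k] l)) := by
    intro y
    induction y with
    | zero => simp
    | tmul a b => simp [tLin, sLin]
    | add y z hy hz => rw [map_add, add_mul, hy, hz, add_mul, map_add]
  have h3 : ∀ y : L ⊗[k] L, (LinearMap.mul' k L).lTensor L
      (TensorProduct.assoc k L L L (y ⊗ₜ[k] l)) = y * (1 ⊗ₜ[k] l) := by
    intro y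
    induction y with
    | zero => simp
    | tmul a b => simp
    | add y z hy hz => rw [TensorProduct.add_tmul, map_add, map_add, hy, hz, add_mul]
  have h4 : ∀ y : L ⊗[k] L, (LinearMap.mul' k L).rTensor L
      ((TensorProduct.assoc k L L L).symm (l ⊗ₜ[k] y)) = (l ⊗ₜ[k] 1) * y := by
    intro y
    induction y with
    | zero => simp
    | tmul a b => simp
    | add y z hy hz => rw [TensorProduct.tmul_add, map_add, map_add, hy, hz, mul_add]
  have h5 : σ.δ 1 * (1 ⊗ₜ[k] l) = σ.δ l := by
    have := LinearMap.congr_fun σ.frobenius_left (1 ⊗ₜ[k] l)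
    simpa [h3] using this
  have h6 : (l ⊗ₜ[k] 1) * σ.δ 1 = σ.δ l := by
    have := LinearMap.congr_fun σ.frobenius_right (l ⊗ₜ[k] 1)
    simpa [h4] using this
  rw [sepElem, h1, h2, h5, h6]

variable (k A) in
/-- The canonical projection `A ⊗ A → A ⊗_k A` from the tensor product over the integers. -/
def toTensor : A ⊗[ℤ] A →+ A ⊗[k] A :=
  liftAdd (AddMonoidHom.mk'
    (fun a => AddMonoidHom.mk' (fun b => a ⊗ₜ[k] b) (TensorProduct.tmul_add a))
    (fun a a' => AddMonoidHom.ext (TensorProduct.add_tmul a a')))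

@[simp] theorem toTensor_tmul (a b : A) : toTensor k A (a ⊗ₜ[ℤ] b) = a ⊗ₜ[k] b := rfl

theorem toTensor_tmul_mul (a b : A) (x : A ⊗[ℤ] A) :
    toTensor k A ((a ⊗ₜ[ℤ] b) * x) = (a ⊗ₜ[k] b) * toTensor k A x := by
  induction x with
  | zero => simp
  | tmul c d => simp
  | add y z hy hz => rw [mul_add, map_add, map_add, mul_add, hy, hz]

/-- The map `a ⊗ b ↦ t(eᵢ) a ⊗ s(fᵢ) b` from the tensor product over `L` to the one
over `k`. -/
def comulAux (hk : B.IsOver k) (σ : SeparabilityStructure k L) :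
    Bal (fun (l : L) (a : A) => B.t (op l) * a) (fun (l : L) (a : A) => B.s l * a) →+
      A ⊗[k] A :=
  Bal.lift _ _ ((AddMonoidHom.mulLeft (B.sepElem hk σ)).comp (toTensor k A)) (fun l a b => by
    have h := congrArg (· * (a ⊗ₜ[k] b)) (B.sepElem_mul hk σ l)
    simp only [mul_assoc, Algebra.TensorProduct.tmul_mul_tmul, one_mul] at h
    simpa using h)

/-- The coproduct `Δ(a) = t(eᵢ) a₁ ⊗ s(fᵢ) a₂`. -/
def weakComul (hk : B.IsOver k) (σ : SeparabilityStructure k L) : A →ₗ[k] A ⊗[k] A where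
  toFun a := B.comulAux hk σ (B.γ a)
  map_add' a b := by rw [map_add, map_add]
  map_smul' c a := by
    obtain ⟨x, hx⟩ := B.exists_rep a
    have h : B.sepElem hk σ * toTensor k A ((B.s (algebraMap k L c) ⊗ₜ[ℤ] 1) * x) =
        c • (B.sepElem hk σ * toTensor k A x) := by
      rw [toTensor_tmul_mul, hk.s_algebraMap, Algebra.algebraMap_eq_smul_one,
        ← TensorProduct.smul_tmul', ← Algebra.TensorProduct.one_def, smul_mul_assoc, one_mul,
        mul_smul_comm]
    rw [RingHom.id_apply, hk.smul_eq_s, B.γ_s_mul _ a x hx, ← hx]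
    exact h

/-- The counit `ε = ψ ∘ π`. -/
def weakCounit (hk : B.IsOver k) (σ : SeparabilityStructure k L) : A →ₗ[k] k :=
  σ.ψ ∘ₗ B.πLin hk

end LeftBialgebroid

namespace HopfAlgebroid

variable {k A L R : Type*} [CommRing k] [Ring A] [Ring L] [Ring R] [Algebra k A] [Algebra k L]
  (H : HopfAlgebroid A L R)

/-- The antipode as a `k`-linear map. -/
def antipode (hk : H.left.IsOver k) : A →ₗ[k] A where
  toFun := H.S
  map_add' := map_add _
  map_smul' c a := by
    have h := H.S_left (algebraMap k L c) 1 a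
    rw [op_one, map_one, map_one, mul_one, one_mul, hk.s_algebraMap, ← hk.smul_eq_t] at h
    rw [h, RingHom.id_apply, Algebra.smul_def, Algebra.commutes]

/-- The twisted antipode `S_g(a) = S(a ↼ g)`. -/
def twistedAntipode (hk : H.left.IsOver k) (τ : H.left.Twist H.S) : A →ₗ[k] A :=
  H.antipode hk ∘ₗ H.left.actLin hk τ.g

end HopfAlgebroid

end HopfAlgd

/-!
The map `φ ↦ ψ ∘ φ` is a ring isomorphism from the dual ring to the convolution algebra of
functionals on `A`: by `convMul_dual`, convolution with `ψ ∘ φ` is precomposition with `a ↦ a ↼ φ`,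
and `dualOf` is the inverse. So `ψ ∘ π ∘ S` has a density `h` in the dual ring, and it is
convolution invertible exactly if `h` has an inverse `g`.

*Conditions forced by the weak Hopf axioms.* For every `g` in the dual ring,
`S_g(a₁) a₂ = t(π(S(a ↼ g)))` with respect to `Δ` (`antipode_mul_act`). Applying `ψ ∘ π` to the
weak Hopf axiom for `S_g(a₁) a₂` gives `ψπS(a ↼ g) = ψπ(a)` (`ψ_antipode_act_of_antipode_mul`).
For the unit `g = π` this is `ψ ∘ π ∘ S = ψ ∘ π`, and for an invertible `g` it says that
`ψ ∘ π ∘ S` is `ψ ∘ g⁻¹`.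

*Weak Hopf structures from the conditions.* Let `g` be the inverse of the density `h`
(`IsInvDensity`). Since `S` is anti-multiplicative (`S_mul`), `↼ h` and hence `↼ g` are ring
automorphisms of `A`. On the base,
`θ ∘ g ∘ s` is the Nakayama automorphism of the Frobenius form `ψ`, where `S(s(l)) = t(θ(l))`.
Therefore the right coproduct lifts to a map `A → A ⊗_k A`, and mixed coassociativity together with
the counits shows that this lift is `(id ⊗ (↼ g)) ∘ Δ` (`comulR_eq`). The antipode axioms of the
right bialgebroid then become the weak Hopf axioms of `S_g`. That `g` is a twist follows from the
injectivity of the Galois map `b ⊗ a ↦ b a⁽¹⁾ ⊗ a⁽²⁾` (`galoisInv_galois`, `galois_eq`). The first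
equivalence of the theorem is the case `g = h = π`.

That `(A, Δ, ε)` is a weak bialgebra (`isWeakBialgebra`) holds because
`x ⊗ y ↦ t(eᵢ) x ⊗ s(fᵢ) y` (`incl`) embeds the balanced tensor product in `A ⊗_k A`, and the
Takeuchi property of the coproduct of the bialgebroid makes the composite `Δ` multiplicative.

Identities in Sweedler notation are written with sums over a chosen representative (`Bal.sum`);
for balanced functions (`IsBal`) the sum does not depend on the representative.
-/

namespace HopfAlgd

/-! ### Sweedler sums -/

section Sweedler

/-- A biadditive function `f` with `f(x · i, y) = f(x, i · y)`, for a right action `ρ` and a left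
action `lam` of `ι`: the functions that descend to the balanced tensor product. -/
structure IsBal {ι X Y P : Type*} [Add X] [Add Y] [Add P] (ρ : ι → X → X) (lam : ι → Y → Y)
    (f : X → Y → P) : Prop where
  add_left : ∀ x x' y, f (x + x') y = f x y + f x' y
  add_right : ∀ x y y', f x (y + y') = f x y + f x y'
  bal : ∀ i x y, f (ρ i x) y = f x (lam i y)

variable {ι ι' A P Q : Type*} [Ring A] [AddCommGroup P] [AddCommGroup Q]

namespace IsBal

variable {ρ lam : ι → A → A} {f : A → A → P}

/-- The additive map on `A ⊗ A` induced by a balanced function. -/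
def hom (hf : IsBal ρ lam f) : A ⊗[ℤ] A →+ P :=
  liftAdd (AddMonoidHom.mk' (fun x => AddMonoidHom.mk' (f x) (hf.add_right x))
    (fun x x' => AddMonoidHom.ext (hf.add_left x x')))

@[simp] theorem hom_tmul (hf : IsBal ρ lam f) (x y : A) : hf.hom (x ⊗ₜ[ℤ] y) = f x y := rfl

theorem map_hom (hf : IsBal ρ lam f) (φ : P →+ Q) : IsBal ρ lam (fun x y => φ (f x y)) :=
  ⟨fun x x' y => by rw [hf.add_left, map_add], fun x y y' => by rw [hf.add_right, map_add],
    fun i x y => by rw [hf.bal]⟩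

end IsBal

variable {ρ lam : ι → A → A}

theorem Bal.exists_fin_rep (z : Bal ρ lam) :
    ∃ n, ∃ x : Fin n → A × A, z = ∑ i, Bal.mk ρ lam ((x i).1 ⊗ₜ[ℤ] (x i).2) := by
  obtain ⟨y, rfl⟩ := Bal.mk_surjective ρ lam z
  obtain ⟨n, u, v, rfl⟩ := TensorProduct.exists_sum_tmul_eq y
  exact ⟨n, fun i => (u i, v i), by rw [map_sum]⟩

/-- The number of terms of a chosen representative of `z`. -/
noncomputable def Bal.len (z : Bal ρ lam) : ℕ := (Bal.exists_fin_rep z).choose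

/-- The terms of a chosen representative of `z`. -/
noncomputable def Bal.terms (z : Bal ρ lam) : Fin (Bal.len z) → A × A :=
  (Bal.exists_fin_rep z).choose_spec.choose

theorem Bal.eq_sum_terms (z : Bal ρ lam) :
    z = ∑ i, Bal.mk ρ lam ((Bal.terms z i).1 ⊗ₜ[ℤ] (Bal.terms z i).2) :=
  (Bal.exists_fin_rep z).choose_spec.choose_spec

/-- The chosen representative of `z`. -/
noncomputable def Bal.rep (z : Bal ρ lam) : A ⊗[ℤ] A :=
  ∑ i, (Bal.terms z i).1 ⊗ₜ[ℤ] (Bal.terms z i).2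

theorem Bal.mk_rep (z : Bal ρ lam) : Bal.mk ρ lam (Bal.rep z) = z := by
  conv_rhs => rw [Bal.eq_sum_terms z]
  rw [Bal.rep, map_sum]

/-- The Sweedler sum `f(z₁, z₂)` over a chosen representative `z₁ ⊗ z₂` of `z`. It is independent
of the representative if `f` is balanced. -/
noncomputable def Bal.sum (z : Bal ρ lam) (f : A → A → P) : P :=
  ∑ i, f (Bal.terms z i).1 (Bal.terms z i).2

theorem Bal.sum_eq_hom {z : Bal ρ lam} {f : A → A → P} (hf : IsBal ρ lam f) {x : A ⊗[ℤ] A}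
    (hx : Bal.mk ρ lam x = z) : Bal.sum z f = hf.hom x := by
  have h : Bal.lift ρ lam hf.hom (fun l a b => hf.bal l a b) z = hf.hom x := by
    rw [← hx]
    rfl
  rw [← h]
  conv_rhs => rw [Bal.eq_sum_terms z]
  rw [map_sum]
  rfl

theorem Bal.sum_add {f : A → A → P} (hf : IsBal ρ lam f) (z z' : Bal ρ lam) :
    Bal.sum (z + z') f = Bal.sum z f + Bal.sum z' f := by
  rw [Bal.sum_eq_hom hf (Bal.mk_rep z), Bal.sum_eq_hom hf (Bal.mk_rep z'), ← map_add]
  exact Bal.sum_eq_hom hf (by rw [map_add, Bal.mk_rep, Bal.mk_rep])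

theorem Bal.sum_congr {f g : A → A → P} (z : Bal ρ lam) (h : ∀ x y, f x y = g x y) :
    Bal.sum z f = Bal.sum z g :=
  Finset.sum_congr rfl fun _ _ => h _ _

theorem Bal.map_sum {F : Type*} [FunLike F P Q] [AddMonoidHomClass F P Q] (φ : F)
    (z : Bal ρ lam) (f : A → A → P) :
    φ (Bal.sum z f) = Bal.sum z fun x y => φ (f x y) :=
  _root_.map_sum φ _ _

theorem Bal.sum_add_fun (z : Bal ρ lam) (f g : A → A → P) :
    Bal.sum z (fun x y => f x y + g x y) = Bal.sum z f + Bal.sum z g :=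
  Finset.sum_add_distrib

theorem Bal.sum_finset_fun {κ : Type*} (s : Finset κ) (z : Bal ρ lam) (f : κ → A → A → P) :
    Bal.sum z (fun x y => ∑ j ∈ s, f j x y) = ∑ j ∈ s, Bal.sum z (f j) :=
  Finset.sum_comm

theorem Bal.sum_comm {ρ' lam' : ι' → A → A} (z : Bal ρ lam) (z' : Bal ρ' lam')
    (f : A → A → A → A → P) :
    Bal.sum z (fun x y => Bal.sum z' fun u v => f x y u v) =
      Bal.sum z' fun u v => Bal.sum z fun x y => f x y u v :=
  Finset.sum_comm

theorem Bal.sum_mul {B : Type*} [NonUnitalNonAssocRing B] (z : Bal ρ lam) (f : A → A → B) (b : B) :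
    Bal.sum z f * b = Bal.sum z fun x y => f x y * b :=
  Finset.sum_mul _ _ _

theorem Bal.mul_sum {B : Type*} [NonUnitalNonAssocRing B] (z : Bal ρ lam) (f : A → A → B) (b : B) :
    b * Bal.sum z f = Bal.sum z fun x y => b * f x y :=
  Finset.mul_sum _ _ _

theorem isBal_mk (ρ lam : ι → A → A) : IsBal ρ lam fun x y => Bal.mk ρ lam (x ⊗ₜ[ℤ] y) :=
  ⟨fun x x' y => by rw [TensorProduct.add_tmul, map_add],
   fun x y y' => by rw [TensorProduct.tmul_add, map_add],
   fun l a b => by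
    rw [← sub_eq_zero, ← map_sub]
    exact (QuotientAddGroup.eq_zero_iff _).2 (AddSubgroup.subset_closure ⟨l, a, b, rfl⟩)⟩

/-- Triadditive functions balanced in both places. -/
structure IsBal₃ (ρ₁ lam₁ : ι → A → A) (ρ₂ lam₂ : ι' → A → A) (F : A → A → A → P) : Prop where
  left : ∀ w, IsBal ρ₁ lam₁ (fun u v => F u v w)
  right : ∀ u, IsBal ρ₂ lam₂ (F u)

namespace IsBal₃

variable {ρ₁ lam₁ : ι → A → A} {ρ₂ lam₂ : ι' → A → A} {F : A → A → A → P}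

/-- The additive map induced on `A ⊗ (A ⊗ A)`. -/
def hom (hF : IsBal₃ ρ₁ lam₁ ρ₂ lam₂ F) : A ⊗[ℤ] (A ⊗[ℤ] A) →+ P :=
  liftAdd (AddMonoidHom.mk' (fun u => (hF.right u).hom) (fun u u' => by
    refine AddMonoidHom.ext fun x => ?_
    induction x with
    | zero => simp
    | tmul v w => simpa using (hF.left w).add_left u u' v
    | add x y hx hy => rw [map_add, map_add, hx, hy]))

theorem hom_tmul (hF : IsBal₃ ρ₁ lam₁ ρ₂ lam₂ F) (u v w : A) :
    hF.hom (u ⊗ₜ[ℤ] (v ⊗ₜ[ℤ] w)) = F u v w := rfl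

/-- The additive map induced on the threefold balanced tensor product. -/
def lift (hF : IsBal₃ ρ₁ lam₁ ρ₂ lam₂ F) : Bal₃ ρ₁ lam₁ ρ₂ lam₂ →+ P :=
  QuotientAddGroup.lift (balRel₃ ρ₁ lam₁ ρ₂ lam₂) hF.hom
    ((AddSubgroup.closure_le (hF.hom.ker)).2 (by
      rintro _ (⟨l, a, b, c, rfl⟩ | ⟨l, a, b, c, rfl⟩)
      · change hF.hom _ = 0
        rw [map_sub, hF.hom_tmul, hF.hom_tmul, sub_eq_zero]
        exact (hF.left c).bal l a b
      · change hF.hom _ = 0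
        rw [map_sub, hF.hom_tmul, hF.hom_tmul, sub_eq_zero]
        exact (hF.right a).bal l b c))

theorem lift_joinLeft (hF : IsBal₃ ρ₁ lam₁ ρ₂ lam₂ F) (z : Bal ρ₁ lam₁) (c : A) :
    hF.lift (joinLeft ρ₁ lam₁ ρ₂ lam₂ z c) = Bal.sum z fun u v => F u v c := by
  conv_lhs => rw [Bal.eq_sum_terms z]
  rw [map_sum, AddMonoidHom.finsetSum_apply, map_sum]
  rfl

theorem lift_joinRight (hF : IsBal₃ ρ₁ lam₁ ρ₂ lam₂ F) (z : Bal ρ₂ lam₂) (c : A) :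
    hF.lift (joinRight ρ₁ lam₁ ρ₂ lam₂ z c) = Bal.sum z fun u v => F c u v := by
  conv_lhs => rw [Bal.eq_sum_terms z]
  rw [map_sum, AddMonoidHom.finsetSum_apply, map_sum]
  rfl

/-- An identity `(γ₁ ⊗ id)(x) = (id ⊗ γ₂)(y)` in terms of Sweedler sums. -/
theorem sum_sum {ι₁ ι₂ : Type*} {ρ₁' lam₁' : ι₁ → A → A} {ρ₂' lam₂' : ι₂ → A → A}
    (hF : IsBal₃ ρ₁ lam₁ ρ₂ lam₂ F) {γ₁ : A →+ Bal ρ₁ lam₁} {γ₂ : A →+ Bal ρ₂ lam₂}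
    {x : Bal ρ₁' lam₁'} {y : Bal ρ₂' lam₂'}
    (h : coLeft ρ₁ lam₁ ρ₂ lam₂ γ₁ (Bal.rep x) = coRight ρ₁ lam₁ ρ₂ lam₂ γ₂ (Bal.rep y)) :
    Bal.sum x (fun p q => Bal.sum (γ₁ p) fun u v => F u v q) =
      Bal.sum y fun p q => Bal.sum (γ₂ q) fun u v => F p u v := by
  have h' := congrArg hF.lift h
  simp only [Bal.rep, map_sum, coLeft_tmul, coRight_tmul, lift_joinLeft, lift_joinRight] at h'
  exact h'

end IsBal₃

end Sweedler

/-! ### Left bialgebroids -/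

namespace LeftBialgebroid

variable {A L : Type*} [Ring A] [Ring L] (B : LeftBialgebroid A L)
  {P Q : Type*} [AddCommGroup P] [AddCommGroup Q]

/-- Functions balanced for the tensor product that contains the coproduct of `B`. -/
abbrev IsBal (f : A → A → P) : Prop :=
  HopfAlgd.IsBal (fun (l : L) (a : A) => B.t (op l) * a) (fun (l : L) (a : A) => B.s l * a) f

/-- The Sweedler sum `f(a₁, a₂)` with `γ(a) = a₁ ⊗ a₂`. -/
noncomputable def sum (a : A) (f : A → A → P) : P := Bal.sum (B.γ a) f

theorem mk_rep (a : A) : Bal.mk _ _ (Bal.rep (B.γ a)) = B.γ a := Bal.mk_rep _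

theorem sum_congr {f g : A → A → P} (a : A) (h : ∀ x y, f x y = g x y) : B.sum a f = B.sum a g :=
  Bal.sum_congr _ h

theorem map_sum {F : Type*} [FunLike F P Q] [AddMonoidHomClass F P Q] (φ : F) (a : A)
    (f : A → A → P) : φ (B.sum a f) = B.sum a fun x y => φ (f x y) :=
  Bal.map_sum φ _ f

theorem sum_mul_const {C : Type*} [NonUnitalNonAssocRing C] (a : A) (f : A → A → C) (c : C) :
    B.sum a f * c = B.sum a fun x y => f x y * c :=
  Bal.sum_mul _ f c

theorem const_mul_sum {C : Type*} [NonUnitalNonAssocRing C] (a : A) (f : A → A → C) (c : C) :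
    c * B.sum a f = B.sum a fun x y => c * f x y :=
  Bal.mul_sum _ f c

theorem sum_finset_fun {κ : Type*} (s : Finset κ) (a : A) (f : κ → A → A → P) :
    B.sum a (fun x y => ∑ j ∈ s, f j x y) = ∑ j ∈ s, B.sum a (f j) :=
  Bal.sum_finset_fun s _ f

variable {B}

theorem sum_eq_hom {f : A → A → P} (hf : B.IsBal f) {a : A} {x : A ⊗[ℤ] A}
    (hx : Bal.mk _ _ x = B.γ a) : B.sum a f = hf.hom x :=
  Bal.sum_eq_hom hf hx

theorem sum_add {f : A → A → P} (hf : B.IsBal f) (a b : A) :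
    B.sum (a + b) f = B.sum a f + B.sum b f := by
  rw [sum, map_add, Bal.sum_add hf]; rfl

/-- The additive map `a ↦ f(a₁, a₂)`. -/
noncomputable def sumHom {f : A → A → P} (hf : B.IsBal f) : A →+ P :=
  AddMonoidHom.mk' (fun a => B.sum a f) (sum_add hf)

theorem sum_sum {f : A → A → P} (hf : B.IsBal f) {ι : Type*} {ρ lam : ι → A → A}
    (z : Bal ρ lam) (g : A → A → A) :
    B.sum (Bal.sum z g) f = Bal.sum z fun x y => B.sum (g x y) f :=
  Bal.map_sum (sumHom hf) z g

variable (B)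

theorem sum_s_counit (a : A) : B.sum a (fun x y => B.s (B.π x) * y) = a := by
  have h := B.counit_left a _ (B.mk_rep a)
  rw [Bal.rep, _root_.map_sum] at h
  exact h

theorem sum_t_counit (a : A) : B.sum a (fun x y => B.t (op (B.π y)) * x) = a := by
  have h := B.counit_right a _ (B.mk_rep a)
  rw [Bal.rep, _root_.map_sum] at h
  exact h

variable {B}

theorem IsBal.mul_left {f : A → A → P} (hf : B.IsBal f) (c : A) :
    B.IsBal (fun x y => f (x * c) y) :=
  ⟨fun x x' y => by rw [add_mul, hf.add_left], fun x y y' => hf.add_right _ _ _,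
    fun l x y => by rw [mul_assoc]; exact hf.bal _ _ _⟩

theorem IsBal.mul_right {f : A → A → P} (hf : B.IsBal f) (c : A) :
    B.IsBal (fun x y => f x (y * c)) :=
  ⟨fun x x' y => hf.add_left _ _ _, fun x y y' => by rw [add_mul, hf.add_right],
    fun l x y => by rw [mul_assoc]; exact hf.bal _ _ _⟩

theorem sum_takeuchi {f : A → A → P} (hf : B.IsBal f) (l : L) (a : A) :
    B.sum a (fun x y => f (x * B.t (op l)) y) = B.sum a fun x y => f x (y * B.s l) := by
  have h := B.takeuchi l a _ (B.mk_rep a)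
  have h1 := Bal.sum_eq_hom hf (x := Bal.rep (B.γ a) * (B.t (op l) ⊗ₜ[ℤ] 1)) h
  have h2 := Bal.sum_eq_hom hf (x := Bal.rep (B.γ a) * (1 ⊗ₜ[ℤ] B.s l)) rfl
  rw [h2] at h1
  simp only [Bal.rep, Finset.sum_mul, _root_.map_sum, Algebra.TensorProduct.tmul_mul_tmul,
    mul_one, IsBal.hom_tmul] at h1
  exact h1.symm

theorem sum_one {f : A → A → P} (hf : B.IsBal f) : B.sum 1 f = f 1 1 :=
  sum_eq_hom hf B.γ_one.symm

theorem sum_mul {f : A → A → P} (hf : B.IsBal f) (a b : A) :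
    B.sum (a * b) f = B.sum a fun x y => B.sum b fun u v => f (x * u) (y * v) := by
  rw [sum_eq_hom hf (B.γ_mul a b _ _ (B.mk_rep a) (B.mk_rep b)).symm]
  simp only [Bal.rep, Finset.sum_mul_sum, _root_.map_sum, Algebra.TensorProduct.tmul_mul_tmul,
    IsBal.hom_tmul]
  rfl

theorem sum_s_mul {f : A → A → P} (hf : B.IsBal f) (l : L) (a : A) :
    B.sum (B.s l * a) f = B.sum a fun x y => f (B.s l * x) y := by
  rw [sum_eq_hom hf (B.γ_s_mul l a _ (B.mk_rep a)).symm]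
  simp only [Bal.rep, Finset.mul_sum, _root_.map_sum, Algebra.TensorProduct.tmul_mul_tmul,
    IsBal.hom_tmul, one_mul]
  rfl

theorem sum_t_mul {f : A → A → P} (hf : B.IsBal f) (l : L) (a : A) :
    B.sum (B.t (op l) * a) f = B.sum a fun x y => f x (B.t (op l) * y) := by
  rw [sum_eq_hom hf (B.γ_t_mul l a _ (B.mk_rep a)).symm]
  simp only [Bal.rep, Finset.mul_sum, _root_.map_sum, Algebra.TensorProduct.tmul_mul_tmul,
    IsBal.hom_tmul, one_mul]
  rfl

theorem γ_s (l : L) : B.γ (B.s l) = Bal.mk _ _ (B.s l ⊗ₜ[ℤ] 1) := by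
  simpa using B.γ_s_mul l 1 _ B.γ_one.symm

theorem γ_t (l : L) : B.γ (B.t (op l)) = Bal.mk _ _ (1 ⊗ₜ[ℤ] B.t (op l)) := by
  simpa using B.γ_t_mul l 1 _ B.γ_one.symm

theorem sum_mul_s {f : A → A → P} (hf : B.IsBal f) (l : L) (a : A) :
    B.sum (a * B.s l) f = B.sum a fun x y => f (x * B.s l) y := by
  rw [sum_eq_hom hf (B.γ_mul a _ _ _ (B.mk_rep a) (γ_s l).symm).symm]
  simp only [Bal.rep, Finset.sum_mul, _root_.map_sum, Algebra.TensorProduct.tmul_mul_tmul,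
    IsBal.hom_tmul, mul_one]
  rfl

theorem sum_mul_t {f : A → A → P} (hf : B.IsBal f) (l : L) (a : A) :
    B.sum (a * B.t (op l)) f = B.sum a fun x y => f x (y * B.t (op l)) := by
  rw [sum_eq_hom hf (B.γ_mul a _ _ _ (B.mk_rep a) (γ_t l).symm).symm]
  simp only [Bal.rep, Finset.sum_mul, _root_.map_sum, Algebra.TensorProduct.tmul_mul_tmul,
    IsBal.hom_tmul, mul_one]
  rfl

theorem sum_coassoc {F : A → A → A → P}
    (hl : ∀ w, B.IsBal fun u v => F u v w) (hr : ∀ u, B.IsBal (F u)) (a : A) :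
    B.sum a (fun x y => B.sum x fun u v => F u v y) =
      B.sum a fun x y => B.sum y fun u v => F x u v :=
  IsBal₃.sum_sum ⟨hl, hr⟩ (B.coassoc a _ (B.mk_rep a))

variable (B)

theorem π_s_mul (l : L) (a : A) : B.π (B.s l * a) = l * B.π a := by
  simpa using B.π_bimodule l 1 a

theorem π_t_mul (l : L) (a : A) : B.π (B.t (op l) * a) = B.π a * l := by
  simpa using B.π_bimodule 1 l a

theorem π_s (l : L) : B.π (B.s l) = l := by
  simpa [B.π_one] using B.π_s_mul l 1

theorem π_t (l : L) : B.π (B.t (op l)) = l := by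
  simpa [B.π_one] using B.π_t_mul l 1

theorem π_mul_t_eq_π_mul_s (a : A) (l : L) : B.π (a * B.t (op l)) = B.π (a * B.s l) := by
  have h := B.π_mul_s a (B.t (op l))
  rwa [B.π_t, eq_comm] at h

theorem t_mul_s (l l' : L) : B.t (op l') * B.s l = B.s l * B.t (op l') := (B.s_mul_t l l').symm

/-! ### The dual ring and its action -/

theorem act_eq_sum (φ : B.Dual) (a : A) : B.act φ a = B.sum a fun x y => B.s (φ.toHom x) * y := by
  change B.actAux φ (B.γ a) = _
  conv_lhs => rw [Bal.eq_sum_terms (B.γ a)]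
  rw [_root_.map_sum]
  rfl

theorem isBal_act (φ : B.Dual) : B.IsBal fun x y => B.s (φ.toHom x) * y :=
  ⟨fun x x' y => by rw [map_add, map_add, add_mul], fun x y y' => mul_add _ _ _,
    fun l x y => by rw [φ.map_t_mul, map_mul, mul_assoc]⟩

@[ext] theorem Dual.ext' {φ ψ : B.Dual} (h : ∀ a, φ.toHom a = ψ.toHom a) : φ = ψ := by
  cases φ; cases ψ
  congr
  exact AddMonoidHom.ext h

theorem act_mul_t (φ : B.Dual) (a : A) (l : L) :
    B.act φ (a * B.t (op l)) = B.act φ a * B.t (op l) := by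
  simp only [act_eq_sum]
  rw [sum_mul_t (B.isBal_act φ), sum_mul_const]
  exact B.sum_congr _ fun x y => (mul_assoc _ _ _).symm

theorem act_s (φ : B.Dual) (l : L) : B.act φ (B.s l) = B.s (φ.toHom (B.s l)) := by
  rw [act_eq_sum, sum_eq_hom (B.isBal_act φ) (γ_s l).symm]
  simp

theorem act_one_eq (φ : B.Dual) : B.act φ 1 = B.s (φ.toHom 1) := by
  rw [act_eq_sum, sum_one (B.isBal_act φ), mul_one]

theorem act_dualOne (a : A) : B.act (Dual.one B) a = a := by
  rw [act_eq_sum]; exact B.sum_s_counit a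

theorem π_act (φ : B.Dual) (a : A) : B.π (B.act φ a) = φ.toHom a := by
  rw [act_eq_sum, map_sum]
  conv_rhs => rw [← B.sum_t_counit a, map_sum]
  exact B.sum_congr _ fun x y => by rw [π_s_mul, φ.map_t_mul]

variable {B}

/-- `γ(a ↼ φ) = (a₁ ↼ φ) ⊗ a₂`. -/
theorem sum_act {f : A → A → P} (hf : B.IsBal f) (φ : B.Dual) (a : A) :
    B.sum (B.act φ a) f = B.sum a fun x y => f (B.act φ x) y := by
  have h := sum_coassoc (B := B) (F := fun u v w => f (B.s (φ.toHom u) * v) w)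
    (fun w => (B.isBal_act φ).map_hom (AddMonoidHom.mk' (fun x => f x w) fun x x' =>
      hf.add_left x x' w))
    (fun u => ⟨fun x x' y => by rw [mul_add, hf.add_left], fun x y y' => hf.add_right _ _ _,
      fun l x y => by
        rw [← mul_assoc, ← B.t_mul_s, mul_assoc]
        exact hf.bal _ _ _⟩) a
  rw [act_eq_sum]
  refine (sum_sum hf _ _).trans (Eq.trans ?_ (h.symm.trans ?_))
  · exact B.sum_congr _ fun x y => sum_s_mul hf _ _
  · exact B.sum_congr _ fun x y => by
      rw [act_eq_sum]
      exact (B.map_sum (AddMonoidHom.mk' (fun x => f x y) fun x x' => hf.add_left x x' y) x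
        fun u v => B.s (φ.toHom u) * v).symm

theorem act_act (φ φ' : B.Dual) (a : A) : B.act φ' (B.act φ a) = B.act (Dual.mul B φ φ') a := by
  rw [act_eq_sum, sum_act (B.isBal_act φ'), act_eq_sum]
  rfl

theorem act_act_of_mul_eq_one {φ φ' : B.Dual} (h : Dual.mul B φ φ' = Dual.one B) (a : A) :
    B.act φ' (B.act φ a) = a := by
  rw [act_act, h, act_dualOne]

end LeftBialgebroid

/-! ### Hopf algebroids -/

namespace HopfAlgebroid

variable {A L R : Type*} [Ring A] [Ring L] [Ring R] (H : HopfAlgebroid A L R)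
  {P Q : Type*} [AddCommGroup P] [AddCommGroup Q]

/-- Functions balanced for the tensor product that contains the coproduct of the right
bialgebroid. -/
abbrev IsBalR (f : A → A → P) : Prop :=
  HopfAlgd.IsBal (fun (r : R) (a : A) => a * H.right.s r)
    (fun (r : R) (a : A) => a * H.right.t (op r)) f

/-- The Sweedler sum `f(a⁽¹⁾, a⁽²⁾)` over the coproduct of the right bialgebroid. -/
noncomputable def sumR (a : A) (f : A → A → P) : P := Bal.sum (H.right.γ a) f

/-- The map `θ : L → L` with `S(s(l)) = t(θ(l))`. -/
def θ : L →+ L :=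
  H.left.π.comp (H.S.toAddMonoidHom.comp H.left.s.toAddMonoidHom)

theorem mk_rep (a : A) : Bal.mk _ _ (Bal.rep (H.right.γ a)) = H.right.γ a := Bal.mk_rep _

theorem sumR_congr {f g : A → A → P} (a : A) (h : ∀ x y, f x y = g x y) :
    H.sumR a f = H.sumR a g :=
  Bal.sum_congr _ h

theorem map_sumR {F : Type*} [FunLike F P Q] [AddMonoidHomClass F P Q] (φ : F) (a : A)
    (f : A → A → P) : φ (H.sumR a f) = H.sumR a fun x y => φ (f x y) :=
  Bal.map_sum φ _ f

theorem sumR_mul_const {C : Type*} [NonUnitalNonAssocRing C] (a : A) (f : A → A → C) (c : C) :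
    H.sumR a f * c = H.sumR a fun x y => f x y * c :=
  Bal.sum_mul _ f c

theorem const_mul_sumR {C : Type*} [NonUnitalNonAssocRing C] (a : A) (f : A → A → C) (c : C) :
    c * H.sumR a f = H.sumR a fun x y => c * f x y :=
  Bal.mul_sum _ f c

variable {H}

theorem sumR_eq_hom {f : A → A → P} (hf : H.IsBalR f) {a : A} {x : A ⊗[ℤ] A}
    (hx : Bal.mk _ _ x = H.right.γ a) : H.sumR a f = hf.hom x :=
  Bal.sum_eq_hom hf hx

theorem sumR_add {f : A → A → P} (hf : H.IsBalR f) (a b : A) :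
    H.sumR (a + b) f = H.sumR a f + H.sumR b f := by
  rw [sumR, map_add, Bal.sum_add hf]; rfl

/-- The additive map `a ↦ f(a⁽¹⁾, a⁽²⁾)`. -/
noncomputable def sumRHom {f : A → A → P} (hf : H.IsBalR f) : A →+ P :=
  AddMonoidHom.mk' (fun a => H.sumR a f) (sumR_add hf)

theorem sumR_sum {f : A → A → P} (hf : H.IsBalR f) {ι : Type*} {ρ lam : ι → A → A}
    (z : Bal ρ lam) (g : A → A → A) :
    H.sumR (Bal.sum z g) f = Bal.sum z fun x y => H.sumR (g x y) f :=
  Bal.map_sum (sumRHom hf) z g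

theorem sumR_takeuchi {f : A → A → P} (hf : H.IsBalR f) (r : R) (a : A) :
    H.sumR a (fun x y => f (H.right.s r * x) y) =
      H.sumR a fun x y => f x (H.right.t (op r) * y) := by
  have h := H.right.takeuchi r a _ (H.mk_rep a)
  have h1 := Bal.sum_eq_hom hf (x := (H.right.s r ⊗ₜ[ℤ] 1) * Bal.rep (H.right.γ a)) h
  have h2 := Bal.sum_eq_hom hf (x := (1 ⊗ₜ[ℤ] H.right.t (op r)) * Bal.rep (H.right.γ a)) rfl
  rw [h2] at h1
  simp only [Bal.rep, Finset.mul_sum, _root_.map_sum, Algebra.TensorProduct.tmul_mul_tmul,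
    one_mul, IsBal.hom_tmul] at h1
  exact h1.symm

theorem sum_sumR {F : A → A → A → P} (hl : ∀ w, H.left.IsBal fun u v => F u v w)
    (hr : ∀ u, H.IsBalR (F u)) (a : A) :
    H.sumR a (fun x y => H.left.sum x fun u v => F u v y) =
      H.left.sum a fun x y => H.sumR y fun u v => F x u v :=
  IsBal₃.sum_sum ⟨hl, hr⟩ (H.coassoc_left_right a _ _ (H.mk_rep a) (H.left.mk_rep a))

theorem sumR_sum_coassoc {F : A → A → A → P} (hl : ∀ w, H.IsBalR fun u v => F u v w)
    (hr : ∀ u, H.left.IsBal (F u)) (a : A) :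
    H.left.sum a (fun x y => H.sumR x fun u v => F u v y) =
      H.sumR a fun x y => H.left.sum y fun u v => F x u v :=
  IsBal₃.sum_sum ⟨hl, hr⟩ (H.coassoc_right_left a _ _ (H.left.mk_rep a) (H.mk_rep a))

variable (H)

theorem S_mul_t (a : A) (l : L) : H.S (a * H.left.t (op l)) = H.left.s l * H.S a := by
  simpa using H.S_left 1 l a

theorem S_t_mul (a : A) (l : L) : H.S (H.left.t (op l) * a) = H.S a * H.left.s l := by
  simpa using H.S_left l 1 a

theorem S_mul_tR (a : A) (r : R) : H.S (a * H.right.t (op r)) = H.right.s r * H.S a := by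
  simpa using H.S_right r 1 a

theorem S_tR_mul (a : A) (r : R) : H.S (H.right.t (op r) * a) = H.S a * H.right.s r := by
  simpa using H.S_right 1 r a

theorem isBal_antipode (c : A) : H.left.IsBal fun x y => H.S x * y * c :=
  ⟨fun x x' y => by rw [map_add, add_mul, add_mul],
    fun x y y' => by rw [mul_add, add_mul],
    fun l x y => by rw [S_t_mul, mul_assoc (H.S x)]⟩

theorem isBal_antipode' : H.left.IsBal fun x y => H.S x * y := by
  simpa using H.isBal_antipode 1

theorem sum_antipode (a : A) : H.left.sum a (fun x y => H.S x * y) = H.right.s (H.right.π a) := by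
  have h := H.antipode_left a _ (H.left.mk_rep a)
  rw [Bal.rep, _root_.map_sum] at h
  exact h

theorem sumR_antipode (a : A) : H.sumR a (fun x y => x * H.S y) = H.left.s (H.left.π a) := by
  have h := H.antipode_right a _ (H.mk_rep a)
  rw [Bal.rep, _root_.map_sum] at h
  exact h

theorem sumR_counit (a : A) :
    H.sumR a (fun x y => y * H.right.t (op (H.right.π x))) = a := by
  have h := H.right.counit_left a _ (H.mk_rep a)
  rw [Bal.rep, _root_.map_sum] at h
  exact h

theorem S_one : H.S 1 = 1 := by
  have h := H.sum_antipode 1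
  rwa [LeftBialgebroid.sum_one H.isBal_antipode', mul_one, H.right.π_one, map_one H.right.s] at h

theorem exists_tR_eq_s (l : L) : ∃ r, H.right.t (op r) = H.left.s l := by
  have h : H.left.s l ∈ Set.range H.right.t := H.range_s ▸ Set.mem_range_self l
  obtain ⟨r, hr⟩ := h
  exact ⟨unop r, hr⟩

theorem exists_s_eq_tR (r : R) : ∃ l, H.left.s l = H.right.t (op r) := by
  have h : H.right.t (op r) ∈ Set.range H.left.s := H.range_s ▸ Set.mem_range_self _
  exact h

theorem exists_t_eq_sR (r : R) : ∃ l, H.left.t (op l) = H.right.s r := by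
  have h : H.right.s r ∈ Set.range H.left.t := H.range_t ▸ Set.mem_range_self _
  obtain ⟨l, hl⟩ := h
  exact ⟨unop l, hl⟩

theorem S_s (l : L) : H.S (H.left.s l) = H.left.t (op (H.θ l)) := by
  obtain ⟨r, hr⟩ := H.exists_tR_eq_s l
  obtain ⟨l', hl'⟩ := H.exists_t_eq_sR r
  have h : H.S (H.left.s l) = H.left.t (op l') := by
    rw [← hr, ← mul_one (H.right.t _), S_tR_mul, S_one, one_mul, hl']
  have h' : H.θ l = l' := by
    change H.left.π (H.S (H.left.s l)) = l'
    rw [h, H.left.π_t]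
  rw [h, h']

theorem sR_eq_t_θ {r : R} {l : L} (h : H.right.t (op r) = H.left.s l) :
    H.right.s r = H.left.t (op (H.θ l)) := by
  rw [← S_s, ← h, ← mul_one (H.right.t _), S_tR_mul, S_one, one_mul]

theorem S_mul_s (a : A) (l : L) : H.S (a * H.left.s l) = H.left.t (op (H.θ l)) * H.S a := by
  obtain ⟨r, hr⟩ := H.exists_tR_eq_s l
  rw [← hr, S_mul_tR, H.sR_eq_t_θ hr]

/-- Balancedness for the right bialgebroid, in terms of the base `L` of the left one. -/
theorem isBalR_of {f : A → A → P} (add_left : ∀ x x' y, f (x + x') y = f x y + f x' y)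
    (add_right : ∀ x y y', f x (y + y') = f x y + f x y')
    (bal : ∀ l x y, f (x * H.left.t (op (H.θ l))) y = f x (y * H.left.s l)) : H.IsBalR f :=
  ⟨add_left, add_right, fun r x y => by
    obtain ⟨l, hl⟩ := H.exists_s_eq_tR r
    rw [← hl, H.sR_eq_t_θ hl.symm, bal]⟩

/-- `s_R(π_R(a)) = t_L(π_L(S(a)))`. -/
theorem sR_πR (a : A) : H.right.s (H.right.π a) = H.left.t (op (H.left.π (H.S a))) := by
  obtain ⟨l, hl⟩ := H.exists_t_eq_sR (H.right.π a)
  have h : H.left.π (H.S a) = l := by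
    rw [← H.left.π_t l, hl, ← sum_antipode, LeftBialgebroid.map_sum]
    conv_lhs => rw [← H.left.sum_t_counit a, LeftBialgebroid.map_sum, LeftBialgebroid.map_sum]
    exact H.left.sum_congr _ fun x y => by rw [S_t_mul, H.left.π_mul_s]
  rw [h, hl]

theorem sum_antipode' (a : A) :
    H.left.sum a (fun x y => H.S x * y) = H.left.t (op (H.left.π (H.S a))) := by
  rw [sum_antipode, sR_πR]

theorem exists_tR_πR (a : A) :
    ∃ l, H.left.s l = H.right.t (op (H.right.π a)) ∧ H.θ l = H.left.π (H.S a) := by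
  obtain ⟨l, hl⟩ := H.exists_s_eq_tR (H.right.π a)
  refine ⟨l, hl, ?_⟩
  rw [← H.left.π_t (H.θ l), ← H.sR_eq_t_θ hl.symm, sR_πR, H.left.π_t]

/-- `t_L(π_L(S(a⁽¹⁾))) S(a⁽²⁾) = S(a)`. -/
theorem sumR_counit_antipode (a : A) :
    H.sumR a (fun x y => H.left.t (op (H.left.π (H.S x))) * H.S y) = H.S a := by
  conv_rhs => rw [← H.sumR_counit a, map_sumR]
  exact H.sumR_congr _ fun x y => by rw [S_mul_tR, sR_πR]

variable {H}

theorem γR_s (l : L) : H.right.γ (H.left.s l) = Bal.mk _ _ (H.left.s l ⊗ₜ[ℤ] 1) := by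
  obtain ⟨r, hr⟩ := H.exists_tR_eq_s l
  have h := H.right.γ_bimodule r 1 1 _ H.right.γ_one.symm
  simpa [hr] using h

theorem sumR_mul_s {f : A → A → P} (hf : H.IsBalR f) (l : L) (a : A) :
    H.sumR (a * H.left.s l) f = H.sumR a fun x y => f (x * H.left.s l) y := by
  rw [sumR_eq_hom hf (H.right.γ_mul a _ _ _ (H.mk_rep a) (γR_s l).symm).symm]
  simp only [Bal.rep, Finset.sum_mul, _root_.map_sum, Algebra.TensorProduct.tmul_mul_tmul,
    IsBal.hom_tmul, mul_one]
  rfl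

theorem sumR_s_mul {f : A → A → P} (hf : H.IsBalR f) (l : L) (a : A) :
    H.sumR (H.left.s l * a) f = H.sumR a fun x y => f (H.left.s l * x) y := by
  rw [sumR_eq_hom hf (H.right.γ_mul _ a _ _ (γR_s l).symm (H.mk_rep a)).symm]
  simp only [Bal.rep, Finset.mul_sum, _root_.map_sum, Algebra.TensorProduct.tmul_mul_tmul,
    IsBal.hom_tmul, one_mul]
  rfl

/-- `γ_R(a ↼ φ) = (a⁽¹⁾ ↼ φ) ⊗ a⁽²⁾`. -/
theorem sumR_act {f : A → A → P} (hf : H.IsBalR f) (φ : H.left.Dual) (a : A) :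
    H.sumR (H.left.act φ a) f = H.sumR a fun x y => f (H.left.act φ x) y := by
  have h := sum_sumR (H := H) (F := fun u v w => f (H.left.s (φ.toHom u) * v) w)
    (fun w => (H.left.isBal_act φ).map_hom (AddMonoidHom.mk' (fun x => f x w) fun x x' =>
      hf.add_left x x' w))
    (fun u => ⟨fun x x' y => by rw [mul_add, hf.add_left], fun x y y' => hf.add_right _ _ _,
      fun r x y => by rw [← mul_assoc]; exact hf.bal _ _ _⟩) a
  rw [LeftBialgebroid.act_eq_sum]
  refine (sumR_sum hf _ _).trans (Eq.trans ?_ (h.symm.trans ?_))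
  · exact H.left.sum_congr _ fun x y => sumR_s_mul hf _ _
  · exact H.sumR_congr _ fun x y => by
      rw [LeftBialgebroid.act_eq_sum]
      exact (H.left.map_sum (AddMonoidHom.mk' (fun x => f x y) fun x x' => hf.add_left x x' y) x
        fun u v => H.left.s (φ.toHom u) * v).symm

/-! ### The antipode is anti-multiplicative -/

theorem isBalR_mul_antipode (c d : A) : H.IsBalR fun x y => x * H.left.s (H.left.π c) * H.S y * d :=
  H.isBalR_of (fun x x' y => by simp only [add_mul])
    (fun x y y' => by rw [map_add, mul_add, add_mul])
    (fun l x y => by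
      rw [S_mul_s, mul_assoc x, H.left.t_mul_s]
      simp only [mul_assoc])

/-- `S(a⁽¹⁾₍₁₎ b⁽¹⁾₍₁₎) a⁽¹⁾₍₂₎ b⁽¹⁾₍₂₎ S(b⁽²⁾) S(a⁽²⁾)`, which computes both `S(ab)`
and `S(b)S(a)`. -/
noncomputable def antiAux (H : HopfAlgebroid A L R) (a b : A) : A :=
  H.sumR b fun b1 b2 => H.left.sum b1 fun u v => H.sumR a fun a1 a2 => H.left.sum a1 fun x y =>
    H.S (x * u) * (y * v) * (H.S b2 * H.S a2)

/-- Contracting `S(x₁) x₂` at `x = a⁽¹⁾ b⁽¹⁾` first turns `antiAux H a b` into `S(b) S(a)`. -/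
theorem antiAux_eq_mul (a b : A) : antiAux H a b = H.S b * H.S a := by
  have hbal : H.IsBalR fun x y => H.right.s (H.right.π x) * H.S y :=
    ⟨fun x x' y => by simp only [map_add, add_mul], fun x y y' => by rw [map_add, mul_add],
      fun r x y => by
        have h := H.right.π_bimodule 1 r x
        rw [op_one, map_one, mul_one, one_mul] at h
        rw [h, map_mul, S_mul_tR, mul_assoc]⟩
  have h1 : antiAux H a b = H.sumR a fun a1 a2 => H.sumR b fun b1 b2 =>
      H.right.s (H.right.π (H.right.s (H.right.π a1) * b1)) * H.S b2 * H.S a2 := by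
    refine Eq.trans ?_ (Bal.sum_comm _ _ _)
    refine H.sumR_congr _ fun b1 b2 => (Bal.sum_comm _ _ _).trans ?_
    refine H.sumR_congr _ fun a1 a2 => (Bal.sum_comm _ _ _).trans ?_
    rw [H.right.π_s_mul, ← H.sum_antipode, mul_assoc, LeftBialgebroid.sum_mul_const,
      LeftBialgebroid.sum_mul (H.isBal_antipode _)]
    rfl
  rw [h1]
  have h2 : ∀ a1 a2, (H.sumR b fun b1 b2 =>
      H.right.s (H.right.π (H.right.s (H.right.π a1) * b1)) * H.S b2 * H.S a2) =
      H.S b * H.S (a2 * H.right.t (op (H.right.π a1))) := by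
    intro a1 a2
    rw [← sumR_mul_const, sumR_takeuchi hbal, S_mul_tR, ← mul_assoc]
    congr 1
    conv_rhs => rw [← H.sumR_counit b, map_sumR, sumR_mul_const]
    exact H.sumR_congr _ fun x y => by rw [S_tR_mul, S_mul_tR, mul_assoc]
  rw [H.sumR_congr _ h2, ← const_mul_sumR, ← map_sumR, sumR_counit]

/-- After moving both coproducts to the right by mixed coassociativity, contracting
`b₍₂₎⁽¹⁾ S(b₍₂₎⁽²⁾)` and then `a₍₂₎⁽¹⁾ S(a₍₂₎⁽²⁾)` turns `antiAux H a b` into `S(ab)`. -/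
theorem antiAux_eq_S_mul (a b : A) : antiAux H a b = H.S (a * b) := by
  let G : A → A → A → A := fun u v w => H.sumR a fun a1 a2 => H.left.sum a1 fun x y =>
    H.S (x * u) * (y * v) * (H.S w * H.S a2)
  have hin : ∀ u v w c : A, H.left.IsBal fun x y => H.S (x * u) * (y * v) * (H.S w * c) :=
    fun u v w c =>
    ⟨fun x x' y => by simp only [add_mul, map_add], fun x y y' => by simp only [add_mul, mul_add],
      fun l x y => by rw [mul_assoc (H.left.t _), S_t_mul]; simp only [mul_assoc]⟩
  -- `G` is balanced in its first two arguments only after summation over `a`, by the Takeuchi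
  -- property of the left coproduct.
  have hGl : ∀ w, H.left.IsBal fun u v => G u v w := fun w =>
    ⟨fun x x' y => by
      simp only [G, mul_add, map_add, add_mul]
      refine Eq.trans (H.sumR_congr _ fun _ _ => Bal.sum_add_fun _ _ _) (Bal.sum_add_fun _ _ _),
     fun x y y' => by
      simp only [G, mul_add, add_mul]
      refine Eq.trans (H.sumR_congr _ fun _ _ => Bal.sum_add_fun _ _ _) (Bal.sum_add_fun _ _ _),
     fun l x y => H.sumR_congr _ fun a1 a2 => by
      simpa only [mul_assoc] using LeftBialgebroid.sum_takeuchi (hin x y w (H.S a2)) l a1⟩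
  have hGr : ∀ u, H.IsBalR (G u) := fun u =>
    H.isBalR_of
     (fun x x' y => by
      simp only [G, mul_add, add_mul]
      refine Eq.trans (H.sumR_congr _ fun _ _ => Bal.sum_add_fun _ _ _) (Bal.sum_add_fun _ _ _))
     (fun x y y' => by
      simp only [G, mul_add, map_add, add_mul]
      refine Eq.trans (H.sumR_congr _ fun _ _ => Bal.sum_add_fun _ _ _) (Bal.sum_add_fun _ _ _))
     (fun l x y => by simp only [G, S_mul_s, mul_assoc])
  have h1 : antiAux H a b = H.left.sum b fun u v => H.sumR v fun v w => G u v w :=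
    sum_sumR hGl hGr b
  have h2 : ∀ u v, (H.sumR v fun v w => G u v w) =
      H.left.sum a fun x y => H.S (H.left.t (op (H.left.π (y * v))) * (x * u)) := by
    intro u v
    have h3 : (H.sumR v fun v w => G u v w) = H.sumR a fun a1 a2 => H.left.sum a1 fun x y =>
        H.S (x * u) * (y * H.left.s (H.left.π v) * H.S a2 * 1) := by
      refine (Bal.sum_comm _ _ _).trans (H.sumR_congr _ fun a1 a2 => ?_)
      refine (Bal.sum_comm _ _ _).trans (H.left.sum_congr _ fun x y => ?_)
      rw [← H.sumR_antipode v, mul_one, const_mul_sumR, sumR_mul_const, const_mul_sumR]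
      exact H.sumR_congr _ fun _ _ => by simp only [mul_assoc]
    rw [h3, sum_sumR (F := fun x y z => H.S (x * u) * (y * H.left.s (H.left.π v) * H.S z * 1))
      (fun w => ⟨fun x x' y => by simp only [add_mul, map_add],
        fun x y y' => by simp only [add_mul, mul_add],
        fun l x y => by rw [mul_assoc (H.left.t _), S_t_mul]; simp only [mul_assoc]⟩)
      (fun x => (isBalR_mul_antipode v 1).map_hom (AddMonoidHom.mulLeft (H.S (x * u))))]
    refine H.left.sum_congr _ fun x y => ?_
    rw [← const_mul_sumR, S_t_mul, ← H.left.π_mul_s,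
      ← H.sumR_antipode (y * H.left.s (H.left.π v)),
      sumR_mul_s (by simpa [H.left.π_one] using isBalR_mul_antipode (H := H) 1 1)]
    simp only [mul_one]
  have hbal : H.left.IsBal fun x y => H.left.t (op (H.left.π y)) * x :=
    ⟨fun x x' y => mul_add _ _ _, fun x y y' => by rw [map_add, op_add, map_add, add_mul],
      fun l x y => by
        rw [H.left.π_s_mul, op_mul, map_mul, mul_assoc]⟩
  rw [h1, H.left.sum_congr _ h2]
  conv_rhs => rw [← H.left.sum_t_counit (a * b), LeftBialgebroid.sum_mul hbal]
  refine (Bal.sum_comm _ _ _).trans ?_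
  rw [LeftBialgebroid.map_sum]
  refine H.left.sum_congr _ fun x y => ?_
  rw [LeftBialgebroid.map_sum]
  rfl

theorem S_mul (a b : A) : H.S (a * b) = H.S b * H.S a := by
  rw [← antiAux_eq_S_mul, antiAux_eq_mul]

end HopfAlgebroid

/-! ### Separability structures -/

namespace SeparabilityStructure

variable {k L P : Type*} [CommRing k] [Ring L] [Algebra k L] [AddCommGroup P]
  (σ : SeparabilityStructure k L)

/-- The number of terms of a chosen representative `∑ eᵢ ⊗ fᵢ` of `δ(1)`. -/
noncomputable def len : ℕ := (TensorProduct.exists_sum_tmul_eq (σ.δ 1)).choose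

/-- The elements `eᵢ` with `δ(1) = ∑ eᵢ ⊗ fᵢ`. -/
noncomputable def e : Fin σ.len → L :=
  (TensorProduct.exists_sum_tmul_eq (σ.δ 1)).choose_spec.choose

/-- The elements `fᵢ` with `δ(1) = ∑ eᵢ ⊗ fᵢ`. -/
noncomputable def f : Fin σ.len → L :=
  (TensorProduct.exists_sum_tmul_eq (σ.δ 1)).choose_spec.choose_spec.choose

theorem δ_one : σ.δ 1 = ∑ i, σ.e i ⊗ₜ[k] σ.f i :=
  (TensorProduct.exists_sum_tmul_eq (σ.δ 1)).choose_spec.choose_spec.choose_spec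

theorem δ_eq_right (l : L) : σ.δ l = ∑ i, σ.e i ⊗ₜ[k] (σ.f i * l) := by
  have h := LinearMap.congr_fun σ.frobenius_left (1 ⊗ₜ[k] l)
  simp only [LinearMap.comp_apply, LinearMap.rTensor_tmul, σ.δ_one, TensorProduct.sum_tmul,
    map_sum, LinearEquiv.coe_coe, TensorProduct.assoc_tmul, LinearMap.lTensor_tmul,
    LinearMap.mul'_apply, one_mul] at h
  exact h.symm

theorem δ_eq_left (l : L) : σ.δ l = ∑ i, (l * σ.e i) ⊗ₜ[k] σ.f i := by
  have h := LinearMap.congr_fun σ.frobenius_right (l ⊗ₜ[k] 1)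
  simp only [LinearMap.comp_apply, LinearMap.lTensor_tmul, σ.δ_one, TensorProduct.tmul_sum,
    map_sum, LinearEquiv.coe_coe, TensorProduct.assoc_symm_tmul, LinearMap.rTensor_tmul,
    LinearMap.mul'_apply, mul_one] at h
  exact h.symm

theorem sum_ψ_mul_e (l : L) : ∑ i, σ.ψ (l * σ.e i) • σ.f i = l := by
  have h := σ.counit_left l
  rw [σ.δ_eq_left] at h
  simpa only [map_sum, LinearMap.rTensor_tmul, TensorProduct.lid_tmul] using h

theorem sum_ψ_f_mul (l : L) : ∑ i, σ.ψ (σ.f i * l) • σ.e i = l := by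
  have h := σ.counit_right l
  rw [σ.δ_eq_right] at h
  simpa only [map_sum, LinearMap.lTensor_tmul, TensorProduct.rid_tmul] using h

theorem sum_ψ_e : ∑ i, σ.ψ (σ.e i) • σ.f i = 1 := by
  simpa using σ.sum_ψ_mul_e 1

theorem sum_e_mul_f : ∑ i, σ.e i * σ.f i = 1 := by
  have h := LinearMap.congr_fun σ.mul_δ 1
  simpa only [LinearMap.comp_apply, σ.δ_one, map_sum, LinearMap.mul'_apply,
    LinearMap.id_apply] using h

theorem eq_of_ψ_mul_left {x y : L} (h : ∀ z, σ.ψ (z * x) = σ.ψ (z * y)) : x = y := by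
  rw [← σ.sum_ψ_f_mul x, ← σ.sum_ψ_f_mul y]
  simp only [h]

theorem eq_of_ψ_mul_right {x y : L} (h : ∀ z, σ.ψ (x * z) = σ.ψ (y * z)) : x = y := by
  rw [← σ.sum_ψ_mul_e x, ← σ.sum_ψ_mul_e y]
  simp only [h]

/-- `eᵢ` and `fᵢ` are dual bases for `ψ`, so functions of `eᵢ ⊗ fᵢ` can be evaluated after
moving a pair of `ψ`-adjoint linear maps from one leg to the other. -/
theorem sum_adjoint [Module k P] (F : L →ₗ[k] L →ₗ[k] P) (u v : L → L)
    (h : ∀ x y, σ.ψ (x * u y) = σ.ψ (v x * y)) :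
    ∑ i, F (u (σ.e i)) (σ.f i) = ∑ i, F (σ.e i) (v (σ.f i)) := by
  have h1 : ∀ i, F (u (σ.e i)) (σ.f i) =
      ∑ j, F (σ.e j) (σ.ψ (v (σ.f j) * σ.e i) • σ.f i) := by
    intro i
    conv_lhs => rw [← σ.sum_ψ_f_mul (u (σ.e i))]
    simp only [map_sum, LinearMap.sum_apply, map_smul, LinearMap.smul_apply, h]
  rw [Finset.sum_congr rfl fun i _ => h1 i, Finset.sum_comm]
  refine Finset.sum_congr rfl fun j _ => ?_
  rw [← map_sum, σ.sum_ψ_mul_e]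

/-- If `N` is the Nakayama automorphism of `ψ`, then `N(fᵢ) eᵢ = 1`. -/
theorem sum_nakayama (N : L → L) (hN : ∀ x y, σ.ψ (x * y) = σ.ψ (y * N x)) :
    ∑ i, N (σ.f i) * σ.e i = 1 := by
  -- `N(fⱼ)` and `eⱼ` are again dual bases for `ψ`.
  have h1 : ∀ w, ∑ j, σ.ψ (σ.e j * w) • N (σ.f j) = w := by
    intro w
    refine σ.eq_of_ψ_mul_left fun z => ?_
    simp only [Finset.mul_sum, map_sum, mul_smul_comm, map_smul, ← hN]
    conv_rhs => rw [← σ.sum_ψ_f_mul z]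
    simp only [Finset.sum_mul, map_sum, smul_mul_assoc, map_smul, smul_eq_mul]
    exact Finset.sum_congr rfl fun _ _ => mul_comm _ _
  have h2 : ∀ j, N (σ.f j) * σ.e j =
      ∑ i, (σ.ψ (σ.e j * σ.e i) • N (σ.f j)) * σ.f i := by
    intro j
    conv_lhs => rw [← σ.sum_ψ_mul_e (σ.e j)]
    simp only [Finset.mul_sum, mul_smul_comm, smul_mul_assoc]
  rw [Finset.sum_congr rfl fun j _ => h2 j, Finset.sum_comm, ← σ.sum_e_mul_f]
  refine Finset.sum_congr rfl fun i _ => ?_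
  rw [← Finset.sum_mul, h1]

/-- An element `φ` of the dual ring is determined by the functional `ψ ∘ φ`. -/
theorem dual_ext {A : Type*} [Ring A] {B : LeftBialgebroid A L} {φ φ' : B.Dual}
    (h : ∀ a, σ.ψ (φ.toHom a) = σ.ψ (φ'.toHom a)) : φ = φ' := by
  refine LeftBialgebroid.Dual.ext' B fun a => σ.eq_of_ψ_mul_right fun z => ?_
  rw [← φ.map_t_mul, ← φ'.map_t_mul, h]

end SeparabilityStructure

/-! ### The weak bialgebra over a separable base -/

namespace LeftBialgebroid

variable {k A L : Type*} [CommRing k] [Ring A] [Ring L] [Algebra k A] [Algebra k L]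
  {B : LeftBialgebroid A L} {P : Type*} [AddCommGroup P]

theorem IsOver.s_smul (hk : B.IsOver k) (c : k) (l : L) : B.s (c • l) = c • B.s l :=
  map_smul (B.sLin hk) c l

theorem IsOver.t_smul (hk : B.IsOver k) (c : k) (l : L) : B.t (op (c • l)) = c • B.t (op l) :=
  map_smul (B.tLin hk) c l

theorem IsOver.π_smul (hk : B.IsOver k) (c : k) (a : A) : B.π (c • a) = c • B.π a :=
  map_smul (B.πLin hk) c a

theorem IsOver.dual_smul (hk : B.IsOver k) (φ : B.Dual) (c : k) (a : A) :
    φ.toHom (c • a) = c • φ.toHom a := by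
  rw [hk.smul_eq_t, φ.map_t_mul, Algebra.smul_def, Algebra.commutes]

theorem s_sum {ι : Type*} (s : Finset ι) (l : ι → L) : B.s (∑ i ∈ s, l i) = ∑ i ∈ s, B.s (l i) :=
  _root_.map_sum B.s _ _

theorem t_sum {ι : Type*} (s : Finset ι) (l : ι → L) :
    B.t (op (∑ i ∈ s, l i)) = ∑ i ∈ s, B.t (op (l i)) := by
  rw [Finset.op_sum, _root_.map_sum]

theorem sepElem_eq (hk : B.IsOver k) (σ : SeparabilityStructure k L) :
    B.sepElem hk σ = ∑ i, B.t (op (σ.e i)) ⊗ₜ[k] B.s (σ.f i) := by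
  rw [sepElem, σ.δ_one, _root_.map_sum]; rfl

/-- The element `t(eᵢ) x ⊗ s(fᵢ) y` of `A ⊗_k A`: the value at `x ⊗ y` of the inclusion of the
balanced tensor product in `A ⊗_k A`. -/
noncomputable def incl (B : LeftBialgebroid A L) (σ : SeparabilityStructure k L) (x y : A) :
    A ⊗[k] A :=
  ∑ i, (B.t (op (σ.e i)) * x) ⊗ₜ[k] (B.s (σ.f i) * y)

theorem weakComul_eq (hk : B.IsOver k) (σ : SeparabilityStructure k L) (a : A) :
    B.weakComul hk σ a = B.sum a (B.incl σ) := by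
  change B.comulAux hk σ (B.γ a) = _
  conv_lhs => rw [Bal.eq_sum_terms (B.γ a)]
  rw [_root_.map_sum]
  refine Finset.sum_congr rfl fun j _ => ?_
  change B.sepElem hk σ * (_ ⊗ₜ[k] _) = _
  rw [sepElem_eq, Finset.sum_mul]
  simp only [Algebra.TensorProduct.tmul_mul_tmul]
  rfl

theorem isBal_incl (hk : B.IsOver k) (σ : SeparabilityStructure k L) : B.IsBal (B.incl σ) :=
  ⟨fun x x' y => by simp only [incl, mul_add, TensorProduct.add_tmul, Finset.sum_add_distrib],
   fun x y y' => by simp only [incl, mul_add, TensorProduct.tmul_add, Finset.sum_add_distrib],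
   fun l x y => by
    have h := congrArg (· * (x ⊗ₜ[k] y)) (B.sepElem_mul hk σ l)
    simpa only [incl, sepElem_eq, Finset.sum_mul, Algebra.TensorProduct.tmul_mul_tmul, mul_one,
      mul_assoc] using h⟩

theorem incl_mul_tmul (σ : SeparabilityStructure k L) (x y p q : A) :
    B.incl σ x y * (p ⊗ₜ[k] q) = B.incl σ (x * p) (y * q) := by
  simp only [incl, Finset.sum_mul, Algebra.TensorProduct.tmul_mul_tmul, mul_assoc]

theorem weakComul_one (hk : B.IsOver k) (σ : SeparabilityStructure k L) :
    B.weakComul hk σ 1 = ∑ i, B.t (op (σ.e i)) ⊗ₜ[k] B.s (σ.f i) := by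
  rw [weakComul_eq, sum_one (isBal_incl hk σ), incl]
  simp only [mul_one]

theorem weakComul_t_mul (hk : B.IsOver k) (σ : SeparabilityStructure k L) (l : L) (a : A) :
    B.weakComul hk σ (B.t (op l) * a) = (1 ⊗ₜ[k] B.t (op l)) * B.weakComul hk σ a := by
  rw [weakComul_eq, sum_t_mul (isBal_incl hk σ), weakComul_eq, const_mul_sum]
  refine B.sum_congr _ fun x y => ?_
  simp only [incl, Finset.mul_sum, Algebra.TensorProduct.tmul_mul_tmul, one_mul, ← mul_assoc,
    B.t_mul_s]

theorem weakComul_s_mul (hk : B.IsOver k) (σ : SeparabilityStructure k L) (l : L) (a : A) :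
    B.weakComul hk σ (B.s l * a) = (B.s l ⊗ₜ[k] 1) * B.weakComul hk σ a := by
  rw [weakComul_eq, sum_s_mul (isBal_incl hk σ), weakComul_eq, const_mul_sum]
  refine B.sum_congr _ fun x y => ?_
  simp only [incl, Finset.mul_sum, Algebra.TensorProduct.tmul_mul_tmul, one_mul, ← mul_assoc,
    B.t_mul_s]

theorem weakCounit_apply (hk : B.IsOver k) (σ : SeparabilityStructure k L) (a : A) :
    B.weakCounit hk σ a = σ.ψ (B.π a) := rfl

theorem sum_ψ_s (hk : B.IsOver k) (σ : SeparabilityStructure k L) (l : L) :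
    ∑ i, σ.ψ (l * σ.e i) • B.s (σ.f i) = B.s l := by
  simp only [← hk.s_smul]
  rw [← s_sum, σ.sum_ψ_mul_e]

theorem sum_ψ_t (hk : B.IsOver k) (σ : SeparabilityStructure k L) (l : L) :
    ∑ i, σ.ψ (σ.f i * l) • B.t (op (σ.e i)) = B.t (op l) := by
  simp only [← hk.t_smul]
  rw [← t_sum, σ.sum_ψ_f_mul]

/-! ### The weak bialgebra axioms -/

theorem weakComul_coassoc (hk : B.IsOver k) (σ : SeparabilityStructure k L) :
    (TensorProduct.assoc k A A A).toLinearMap ∘ₗ (B.weakComul hk σ).rTensor A ∘ₗ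
      B.weakComul hk σ = (B.weakComul hk σ).lTensor A ∘ₗ B.weakComul hk σ := by
  have hD := isBal_incl hk σ
  let F : A → A → A → A ⊗[k] (A ⊗[k] A) := fun u v w => ∑ i, TensorProduct.assoc k A A A
    (((1 ⊗ₜ[k] B.t (op (σ.e i))) * B.incl σ u v) ⊗ₜ[k] (B.s (σ.f i) * w))
  -- `F` is the inclusion of the threefold balanced tensor product, written as `incl` in the first
  -- two legs and as `incl` in the last two; the two forms show the two balancing conditions.
  have hF : ∀ u v w, F u v w = ∑ j, (B.t (op (σ.e j)) * u) ⊗ₜ[k]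
      ((B.s (σ.f j) ⊗ₜ[k] 1) * B.incl σ v w) := by
    intro u v w
    simp only [F, incl, Finset.mul_sum, Algebra.TensorProduct.tmul_mul_tmul, one_mul,
      TensorProduct.sum_tmul, TensorProduct.tmul_sum, _root_.map_sum, TensorProduct.assoc_tmul]
    rw [Finset.sum_comm]
    simp only [← mul_assoc, B.t_mul_s]
  have hl : ∀ w, B.IsBal fun u v => F u v w := fun w =>
    ⟨fun x x' y => by
      simp only [F, hD.add_left, mul_add, TensorProduct.add_tmul, map_add,
        Finset.sum_add_distrib],
     fun x y y' => by
      simp only [F, hD.add_right, mul_add, TensorProduct.add_tmul, map_add,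
        Finset.sum_add_distrib],
     fun l x y => by simp only [F, hD.bal]⟩
  have hr : ∀ u, B.IsBal (F u) := fun u =>
    ⟨fun x x' y => by
      simp only [hF, hD.add_left, mul_add, TensorProduct.tmul_add, Finset.sum_add_distrib],
     fun x y y' => by
      simp only [hF, hD.add_right, mul_add, TensorProduct.tmul_add, Finset.sum_add_distrib],
     fun l x y => by simp only [hF, hD.bal]⟩
  refine LinearMap.ext fun a => ?_
  simp only [LinearMap.comp_apply, LinearEquiv.coe_coe]
  rw [weakComul_eq hk σ a, map_sum, map_sum, map_sum]
  refine Eq.trans ?_ ((sum_coassoc hl hr a).trans ?_)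
  · refine B.sum_congr _ fun x y => ?_
    simp only [incl, _root_.map_sum, LinearMap.rTensor_tmul, weakComul_t_mul, F]
    rw [sum_finset_fun]
    refine Finset.sum_congr rfl fun i _ => ?_
    rw [weakComul_eq, const_mul_sum]
    exact B.map_sum ((TensorProduct.assoc k A A A).toLinearMap ∘ₗ
      (TensorProduct.mk k (A ⊗[k] A) A).flip (B.s (σ.f i) * y)) x _
  · refine B.sum_congr _ fun x y => ?_
    simp only [hF]
    simp only [incl, _root_.map_sum, LinearMap.lTensor_tmul, weakComul_s_mul]
    rw [sum_finset_fun]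
    refine Finset.sum_congr rfl fun i _ => ?_
    rw [weakComul_eq, const_mul_sum]
    exact (B.map_sum (TensorProduct.mk k A (A ⊗[k] A) (B.t (op (σ.e i)) * x)) y _).symm

theorem weakCounit_left (hk : B.IsOver k) (σ : SeparabilityStructure k L) (a : A) :
    TensorProduct.lid k A ((B.weakCounit hk σ).rTensor A (B.weakComul hk σ a)) = a := by
  rw [weakComul_eq, map_sum, map_sum]
  conv_rhs => rw [← B.sum_s_counit a]
  refine B.sum_congr _ fun x y => ?_
  simp only [incl, _root_.map_sum, LinearMap.rTensor_tmul, TensorProduct.lid_tmul,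
    weakCounit_apply, π_t_mul, ← smul_mul_assoc]
  rw [← Finset.sum_mul, sum_ψ_s hk]

theorem weakCounit_right (hk : B.IsOver k) (σ : SeparabilityStructure k L) (a : A) :
    TensorProduct.rid k A ((B.weakCounit hk σ).lTensor A (B.weakComul hk σ a)) = a := by
  rw [weakComul_eq, map_sum, map_sum]
  conv_rhs => rw [← B.sum_t_counit a]
  refine B.sum_congr _ fun x y => ?_
  simp only [incl, _root_.map_sum, LinearMap.lTensor_tmul, TensorProduct.rid_tmul,
    weakCounit_apply, π_s_mul, ← smul_mul_assoc]
  rw [← Finset.sum_mul, sum_ψ_t hk]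

/-- Multiplicativity: by the Takeuchi property, the factor `t(eⱼ) ⊗ s(fⱼ)` of `Δ(b)` acts on
`a₁ ⊗ a₂` from the right as `1 ⊗ s(eⱼ fⱼ) = 1`. -/
theorem weakComul_mul (hk : B.IsOver k) (σ : SeparabilityStructure k L) (a b : A) :
    B.weakComul hk σ (a * b) = B.weakComul hk σ a * B.weakComul hk σ b := by
  have hD := isBal_incl hk σ
  have hD' : ∀ p q, B.IsBal fun x y => B.incl σ (x * p) (y * q) := fun p q =>
    (hD.mul_left p).mul_right q
  rw [weakComul_eq, sum_mul hD, weakComul_eq, weakComul_eq, sum_mul_const]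
  simp only [const_mul_sum]
  refine (Bal.sum_comm _ _ _).trans (Eq.trans ?_ (Bal.sum_comm _ _ _).symm)
  refine B.sum_congr _ fun u v => ?_
  have h : ∀ x y, B.incl σ x y * B.incl σ u v = ∑ j,
      B.incl σ (x * B.t (op (σ.e j)) * u) (y * (B.s (σ.f j) * v)) := by
    intro x y
    conv_lhs => rw [incl.eq_1 B σ u v]
    simp only [Finset.mul_sum, incl_mul_tmul, mul_assoc]
  refine Eq.trans ?_ (B.sum_congr _ h).symm
  rw [sum_finset_fun]
  have h2 : ∀ j, (B.sum a fun x y =>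
      B.incl σ (x * B.t (op (σ.e j)) * u) (y * (B.s (σ.f j) * v))) =
      B.sum a fun x y => B.incl σ (x * u) (y * (B.s (σ.e j) * B.s (σ.f j) * v)) := fun j => by
    simpa only [mul_assoc] using sum_takeuchi (hD' u (B.s (σ.f j) * v)) (σ.e j) a
  rw [Finset.sum_congr rfl fun j _ => h2 j, ← sum_finset_fun]
  refine B.sum_congr _ fun x y => ?_
  refine Eq.trans ?_ (_root_.map_sum (AddMonoidHom.mk' (B.incl σ (x * u)) (hD.add_right _))
    (fun j => y * (B.s (σ.e j) * B.s (σ.f j) * v)) _)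
  rw [← Finset.mul_sum, ← Finset.sum_mul]
  simp only [← map_mul]
  rw [← s_sum, σ.sum_e_mul_f, map_one, one_mul]
  rfl

theorem isWeakBialgebra (hk : B.IsOver k) (σ : SeparabilityStructure k L) :
    IsWeakBialgebra (B.weakComul hk σ) (B.weakCounit hk σ) where
  coassoc := weakComul_coassoc hk σ
  counit_left := weakCounit_left hk σ
  counit_right := weakCounit_right hk σ
  comul_mul := weakComul_mul hk σ
  comul_one_left := by
    rw [weakComul_one]
    simp only [_root_.map_sum, LinearMap.rTensor_tmul, TensorProduct.sum_tmul,
      TensorProduct.tmul_sum, TensorProduct.assoc_symm_tmul]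
    have h : ∀ j, B.weakComul hk σ (B.t (op (σ.e j))) =
        ∑ i, B.t (op (σ.e i)) ⊗ₜ[k] (B.s (σ.f i) * B.t (op (σ.e j))) := by
      intro j
      rw [← mul_one (B.t _), weakComul_t_mul, weakComul_one, Finset.mul_sum]
      simp only [Algebra.TensorProduct.tmul_mul_tmul, one_mul, mul_one, B.t_mul_s]
    simp only [h, TensorProduct.sum_tmul]
    rw [Finset.sum_mul_sum, Finset.sum_comm]
    simp only [Algebra.TensorProduct.tmul_mul_tmul, one_mul, mul_one]
  comul_one_right := by
    rw [weakComul_one]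
    simp only [_root_.map_sum, LinearMap.rTensor_tmul, TensorProduct.sum_tmul,
      TensorProduct.tmul_sum, TensorProduct.assoc_symm_tmul]
    have h : ∀ j, B.weakComul hk σ (B.t (op (σ.e j))) =
        ∑ i, B.t (op (σ.e i)) ⊗ₜ[k] (B.t (op (σ.e j)) * B.s (σ.f i)) := by
      intro j
      rw [← mul_one (B.t _), weakComul_t_mul, weakComul_one, Finset.mul_sum]
      simp only [Algebra.TensorProduct.tmul_mul_tmul, one_mul, mul_one]
    simp only [h, TensorProduct.sum_tmul]
    rw [Finset.sum_mul_sum]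
    simp only [Algebra.TensorProduct.tmul_mul_tmul, one_mul, mul_one]
  counit_mul_left a b c := by
    have hbal : B.IsBal fun x y => B.t (op (B.π y)) * x :=
      ⟨fun x x' y => mul_add _ _ _, fun x y y' => by rw [map_add, op_add, map_add, add_mul],
        fun l x y => by rw [π_s_mul, op_mul, map_mul, mul_assoc]⟩
    have h1 : ∀ x y, LinearMap.mul' k k (TensorProduct.map (B.weakCounit hk σ ∘ₗ
        LinearMap.mulLeft k a) (B.weakCounit hk σ ∘ₗ LinearMap.mulRight k c) (B.incl σ x y)) =
        B.weakCounit hk σ (a * (B.t (op (B.π (y * B.s (B.π c)))) * x)) := by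
      intro x y
      rw [π_mul_s, ← sum_ψ_t hk σ]
      simp only [incl, _root_.map_sum, TensorProduct.map_tmul, LinearMap.mul'_apply,
        LinearMap.comp_apply, LinearMap.mulLeft_apply, LinearMap.mulRight_apply, Finset.sum_mul,
        Finset.mul_sum, smul_mul_assoc, mul_smul_comm, map_smul, smul_eq_mul]
      refine Finset.sum_congr rfl fun i _ => ?_
      rw [mul_comm, weakCounit_apply hk σ (_ * c), mul_assoc, π_s_mul]
    rw [weakComul_eq, map_sum, map_sum, B.sum_congr _ h1, ← map_sum, ← const_mul_sum]
    rw [← sum_takeuchi hbal]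
    simp only [← mul_assoc]
    rw [← sum_mul_const, B.sum_t_counit, ← mul_assoc, weakCounit_apply, weakCounit_apply,
      π_mul_t]
  counit_mul_right a b c := by
    have hbal : B.IsBal fun x y => B.s (B.π x) * y :=
      ⟨fun x x' y => by rw [map_add, map_add, add_mul], fun x y y' => mul_add _ _ _,
        fun l x y => by rw [π_t_mul, map_mul, mul_assoc]⟩
    have h1 : ∀ x y, LinearMap.mul' k k (TensorProduct.map (B.weakCounit hk σ ∘ₗ
        LinearMap.mulRight k c) (B.weakCounit hk σ ∘ₗ LinearMap.mulLeft k a) (B.incl σ x y)) =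
        B.weakCounit hk σ (a * (B.s (B.π (x * B.t (op (B.π c)))) * y)) := by
      intro x y
      rw [π_mul_t, ← sum_ψ_s hk σ]
      simp only [incl, _root_.map_sum, TensorProduct.map_tmul, LinearMap.mul'_apply,
        LinearMap.comp_apply, LinearMap.mulLeft_apply, LinearMap.mulRight_apply, Finset.sum_mul,
        Finset.mul_sum, smul_mul_assoc, mul_smul_comm, map_smul, smul_eq_mul]
      refine Finset.sum_congr rfl fun i _ => ?_
      rw [weakCounit_apply hk σ (_ * c), mul_assoc, π_t_mul]
    rw [weakComul_eq, map_sum, map_sum, B.sum_congr _ h1, ← map_sum, ← const_mul_sum]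
    rw [sum_takeuchi hbal]
    simp only [← mul_assoc]
    rw [← sum_mul_const, B.sum_s_counit, ← mul_assoc, weakCounit_apply, weakCounit_apply,
      π_mul_s]

/-! ### The dual ring and the convolution algebra -/

/-- An element of the dual ring is `k`-linear. -/
def dualLin (hk : B.IsOver k) (φ : B.Dual) : A →ₗ[k] L where
  toFun := φ.toHom
  map_add' := map_add _
  map_smul' := hk.dual_smul φ

/-- Convolution with a functional `ψ ∘ φ`, for `φ` in the dual ring, is precomposition with
`a ↦ a ↼ φ`. -/
theorem convMul_dual (hk : B.IsOver k) (σ : SeparabilityStructure k L) (φ : B.Dual)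
    (χ : A →ₗ[k] k) : convMul (B.weakComul hk σ) (σ.ψ ∘ₗ dualLin hk φ) χ = χ ∘ₗ B.actLin hk φ := by
  refine LinearMap.ext fun a => ?_
  change LinearMap.mul' k k (TensorProduct.map _ _ (B.weakComul hk σ a)) = χ (B.act φ a)
  rw [weakComul_eq, map_sum, map_sum, act_eq_sum, map_sum]
  refine B.sum_congr _ fun x y => ?_
  rw [← sum_ψ_s hk σ]
  simp only [incl, _root_.map_sum, TensorProduct.map_tmul, LinearMap.mul'_apply,
    LinearMap.comp_apply, Finset.sum_mul, smul_mul_assoc, map_smul, smul_eq_mul]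
  refine Finset.sum_congr rfl fun i _ => ?_
  congr 2
  exact φ.map_t_mul _ _

/-- The element `a ↦ χ(t(eᵢ) a) fᵢ` of the dual ring attached to a functional `χ` on `A`. -/
noncomputable def dualOf (hk : B.IsOver k) (σ : SeparabilityStructure k L)
    (χ : A →ₗ[k] k) : B.Dual where
  toHom := AddMonoidHom.mk' (fun a => ∑ i, χ (B.t (op (σ.e i)) * a) • σ.f i) (fun a b => by
    simp only [mul_add, map_add, add_smul, Finset.sum_add_distrib])
  map_t_mul l a := by
    have h := σ.sum_adjoint (LinearMap.mk₂ k (fun p q => χ (B.t (op p) * a) • q)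
      (fun p p' q => by rw [op_add, map_add, add_mul, map_add, add_smul])
      (fun c p q => by rw [hk.t_smul, smul_mul_assoc, map_smul, smul_assoc])
      (fun p q q' => smul_add _ _ _) (fun c p q => smul_comm _ _ _))
      (fun p => l * p) (fun q => q * l) (fun x y => by rw [mul_assoc])
    simpa only [AddMonoidHom.mk'_apply, LinearMap.mk₂_apply, op_mul, map_mul, mul_assoc,
      ← smul_mul_assoc, ← Finset.sum_mul] using h

theorem ψ_dualOf (hk : B.IsOver k) (σ : SeparabilityStructure k L) (χ : A →ₗ[k] k) (a : A) :
    σ.ψ ((dualOf hk σ χ).toHom a) = χ a := by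
  change σ.ψ (∑ i, χ (B.t (op (σ.e i)) * a) • σ.f i) = χ a
  rw [_root_.map_sum]
  have h := B.sum_ψ_t hk σ 1
  conv_rhs => rw [← one_mul a, ← B.t.map_one, ← op_one, ← h, Finset.sum_mul, _root_.map_sum]
  refine Finset.sum_congr rfl fun i _ => ?_
  rw [map_smul, smul_mul_assoc, map_smul, mul_one, smul_eq_mul, smul_eq_mul, mul_comm]

theorem convMul_eq_counit (hk : B.IsOver k) (σ : SeparabilityStructure k L) {φ φ' : B.Dual}
    (h : Dual.mul B φ φ' = Dual.one B) :
    convMul (B.weakComul hk σ) (σ.ψ ∘ₗ dualLin hk φ) (σ.ψ ∘ₗ dualLin hk φ') =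
      B.weakCounit hk σ := by
  rw [convMul_dual]
  exact LinearMap.ext fun a => congrArg (fun ξ => σ.ψ (ξ.toHom a)) h

theorem dualOf_mul_dualOf (hk : B.IsOver k) (σ : SeparabilityStructure k L) {χ χ' : A →ₗ[k] k}
    (h : convMul (B.weakComul hk σ) χ χ' = B.weakCounit hk σ) :
    Dual.mul B (dualOf hk σ χ) (dualOf hk σ χ') = Dual.one B := by
  have hχ : σ.ψ ∘ₗ dualLin hk (dualOf hk σ χ) = χ := LinearMap.ext (ψ_dualOf hk σ χ)
  rw [← hχ, convMul_dual] at h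
  exact σ.dual_ext fun a => (ψ_dualOf hk σ χ' _).trans (LinearMap.congr_fun h a)

end LeftBialgebroid

/-! ### The density of `ψ ∘ π ∘ S` -/

namespace HopfAlgebroid

variable {k A L R : Type*} [CommRing k] [Ring A] [Ring L] [Ring R] [Algebra k L]

/-- `h` is the density of `ψ ∘ π ∘ S`, that is, the element of the dual ring with
`ψ ∘ h = ψ ∘ π ∘ S`, and `g` is its inverse in the dual ring. -/
structure IsInvDensity (H : HopfAlgebroid A L R) (σ : SeparabilityStructure k L)
    (g h : H.left.Dual) : Prop where
  ψ_apply : ∀ a, σ.ψ (h.toHom a) = σ.ψ (H.left.π (H.S a))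
  mul_inv : LeftBialgebroid.Dual.mul H.left g h = LeftBialgebroid.Dual.one H.left
  inv_mul : LeftBialgebroid.Dual.mul H.left h g = LeftBialgebroid.Dual.one H.left

namespace IsInvDensity

variable {H : HopfAlgebroid A L R} {σ : SeparabilityStructure k L} {g h : H.left.Dual}

theorem ψ_mul (hd : H.IsInvDensity σ g h) (a : A) (z : L) :
    σ.ψ (h.toHom a * z) = σ.ψ (H.left.π (H.S a * H.left.s z)) := by
  rw [← h.map_t_mul, hd.ψ_apply, S_t_mul]

theorem apply_one (hd : H.IsInvDensity σ g h) : h.toHom 1 = 1 := by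
  refine σ.eq_of_ψ_mul_right fun z => ?_
  rw [hd.ψ_mul, S_one, one_mul, one_mul, H.left.π_s]

/-- The identity behind the multiplicativity of `↼ h`. After applying `ψ` it says that
`ψπ(S(b) s(π(S(a)))) = ψπ(S(b) S(a))`, where `S(b) S(a) = S(ab)`. -/
theorem apply_mul_t (hd : H.IsInvDensity σ g h) (a b : A) :
    h.toHom (a * H.left.t (op (h.toHom b))) = h.toHom (a * b) := by
  refine σ.eq_of_ψ_mul_right fun z => ?_
  rw [hd.ψ_mul, hd.ψ_mul, S_mul_t, mul_assoc, H.left.π_s_mul, hd.ψ_mul, H.left.π_mul_s, S_mul,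
    mul_assoc]

/-- The action of the density is multiplicative. -/
theorem density_act_mul (hd : H.IsInvDensity σ g h) (a b : A) :
    H.left.act h a * H.left.act h b = H.left.act h (a * b) := by
  have hb := H.left.isBal_act h
  rw [H.left.act_eq_sum h (a * b), LeftBialgebroid.sum_mul hb, H.left.act_eq_sum h b,
    LeftBialgebroid.const_mul_sum]
  refine Eq.trans ?_ (Bal.sum_comm _ _ _)
  refine H.left.sum_congr _ fun u v => ?_
  have h1 := LeftBialgebroid.sum_takeuchi (hb.mul_right v) (h.toHom u) a
  rw [H.left.act_eq_sum, LeftBialgebroid.sum_mul_const]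
  simp only [hd.apply_mul_t, mul_assoc] at h1 ⊢
  exact h1.symm

theorem act_act (hd : H.IsInvDensity σ g h) (a : A) : H.left.act g (H.left.act h a) = a :=
  H.left.act_act_of_mul_eq_one hd.inv_mul a

theorem act_act' (hd : H.IsInvDensity σ g h) (a : A) : H.left.act h (H.left.act g a) = a :=
  H.left.act_act_of_mul_eq_one hd.mul_inv a

theorem act_mul (hd : H.IsInvDensity σ g h) (a b : A) :
    H.left.act g a * H.left.act g b = H.left.act g (a * b) := by
  rw [← hd.act_act (H.left.act g a * H.left.act g b), ← hd.density_act_mul, hd.act_act',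
    hd.act_act']

theorem act_one (hd : H.IsInvDensity σ g h) : H.left.act g 1 = 1 := by
  have h1 := hd.act_act 1
  rwa [H.left.act_one_eq h, hd.apply_one, map_one] at h1

/-- The automorphism `h ∘ s` of `L` is the composite of `θ` with the inverse of the Nakayama
automorphism of `ψ`. -/
theorem ψ_apply_s_mul (hd : H.IsInvDensity σ g h) (l w : L) :
    σ.ψ (h.toHom (H.left.s l) * w) = σ.ψ (w * H.θ l) := by
  rw [hd.ψ_mul, S_s, H.left.π_t_mul, H.left.π_s]

theorem density_apply_s_apply_s (hd : H.IsInvDensity σ g h) (l : L) :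
    h.toHom (H.left.s (g.toHom (H.left.s l))) = l := by
  rw [← H.left.π_s (h.toHom _), ← H.left.act_s, ← H.left.act_s, hd.act_act', H.left.π_s]

theorem apply_s_density_apply_s (hd : H.IsInvDensity σ g h) (l : L) :
    g.toHom (H.left.s (h.toHom (H.left.s l))) = l := by
  rw [← H.left.π_s (g.toHom _), ← H.left.act_s, ← H.left.act_s, hd.act_act, H.left.π_s]

theorem apply_s_mul_s (hd : H.IsInvDensity σ g h) (l m : L) :
    g.toHom (H.left.s (l * m)) = g.toHom (H.left.s l) * g.toHom (H.left.s m) := by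
  rw [← H.left.π_s (g.toHom (H.left.s (l * m))), ← H.left.act_s, map_mul, ← hd.act_mul,
    H.left.act_s, H.left.act_s, ← map_mul, H.left.π_s]

/-- `θ ∘ g ∘ s` is the Nakayama automorphism of `ψ`. -/
theorem ψ_mul_comm (hd : H.IsInvDensity σ g h) (x y : L) :
    σ.ψ (x * y) = σ.ψ (y * H.θ (g.toHom (H.left.s x))) := by
  rw [← hd.ψ_apply_s_mul, hd.density_apply_s_apply_s]

theorem sum_θ_mul (hd : H.IsInvDensity σ g h) :
    ∑ i, H.θ (g.toHom (H.left.s (σ.f i))) * σ.e i = 1 :=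
  σ.sum_nakayama (fun x => H.θ (g.toHom (H.left.s x))) hd.ψ_mul_comm

theorem ψ_density_act (hd : H.IsInvDensity σ g h) (a : A) :
    σ.ψ (H.left.π (H.S (H.left.act g a))) = σ.ψ (H.left.π a) := by
  rw [← hd.ψ_apply]
  have h1 : h.toHom (H.left.act g a) = (LeftBialgebroid.Dual.mul H.left g h).toHom a := rfl
  rw [h1, hd.mul_inv]
  rfl

/-- If `ψ ∘ π ∘ S = ψ ∘ π`, the density is the unit of the dual ring. -/
theorem one (h : ∀ a, σ.ψ (H.left.π (H.S a)) = σ.ψ (H.left.π a)) :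
    H.IsInvDensity σ (LeftBialgebroid.Dual.one H.left) (LeftBialgebroid.Dual.one H.left) :=
  have hmul : LeftBialgebroid.Dual.mul H.left (LeftBialgebroid.Dual.one H.left)
      (LeftBialgebroid.Dual.one H.left) = LeftBialgebroid.Dual.one H.left :=
    LeftBialgebroid.Dual.ext' H.left fun a => congrArg H.left.π (H.left.act_dualOne a)
  ⟨fun a => (h a).symm, hmul, hmul⟩

end IsInvDensity

/-! ### The weak comultiplication in terms of the right bialgebroid -/

section RightComul

variable [Algebra k A] {H : HopfAlgebroid A L R}

/-- The element `x t(eᵢ) ⊗ y s(g(s(fᵢ)))` of `A ⊗_k A`. If `g` is the inverse of the density of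
`ψ ∘ π ∘ S`, it depends only on the class of `x ⊗ y` in the tensor product over `R`. -/
noncomputable def inclR (H : HopfAlgebroid A L R) (σ : SeparabilityStructure k L)
    (g : H.left.Dual) (x y : A) : A ⊗[k] A :=
  ∑ i, (x * H.left.t (op (σ.e i))) ⊗ₜ[k] (y * H.left.s (g.toHom (H.left.s (σ.f i))))

/-- The image `a⁽¹⁾ t(eᵢ) ⊗ a⁽²⁾ s(g(s(fᵢ)))` in `A ⊗_k A` of the right coproduct of `a`. -/
noncomputable def comulR (H : HopfAlgebroid A L R) (σ : SeparabilityStructure k L)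
    (g : H.left.Dual) (a : A) : A ⊗[k] A :=
  H.sumR a (H.inclR σ g)

variable {σ : SeparabilityStructure k L} {g h : H.left.Dual}

theorem isBalR_inclR (hk : H.left.IsOver k) (hd : H.IsInvDensity σ g h) :
    H.IsBalR (H.inclR σ g) :=
  H.isBalR_of
    (fun x x' y => by
      simp only [inclR, add_mul, TensorProduct.add_tmul, Finset.sum_add_distrib])
    (fun x y y' => by
      simp only [inclR, add_mul, TensorProduct.tmul_add, Finset.sum_add_distrib])
    (fun l x y => by
      have h1 := σ.sum_adjoint ((TensorProduct.mk k A A).compl₁₂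
        (LinearMap.mulLeft k x ∘ₗ H.left.tLin hk)
        (LinearMap.mulLeft k y ∘ₗ H.left.sLin hk ∘ₗ LeftBialgebroid.dualLin hk g ∘ₗ
          H.left.sLin hk)) (fun e => e * H.θ l) (fun f => h.toHom (H.left.s l) * f)
        (fun p q => by rw [← mul_assoc, ← hd.ψ_apply_s_mul, mul_assoc])
      have h2 : ∀ p q, (TensorProduct.mk k A A).compl₁₂
        (LinearMap.mulLeft k x ∘ₗ H.left.tLin hk)
        (LinearMap.mulLeft k y ∘ₗ H.left.sLin hk ∘ₗ LeftBialgebroid.dualLin hk g ∘ₗ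
          H.left.sLin hk) p q =
          (x * H.left.t (op p)) ⊗ₜ[k] (y * H.left.s (g.toHom (H.left.s q))) := fun p q => rfl
      simp only [h2, hd.apply_s_mul_s, hd.apply_s_density_apply_s] at h1
      simpa only [inclR, op_mul, map_mul, mul_assoc] using h1)

/-- `ψ ∘ π ∘ S` is a left counit for the right coproduct. -/
theorem antipode_counit_comulR (hk : H.left.IsOver k) (hd : H.IsInvDensity σ g h) (a : A) :
    TensorProduct.lid k A ((σ.ψ ∘ₗ H.left.πLin hk ∘ₗ H.antipode hk).rTensor A
      (H.comulR σ g a)) = a := by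
  rw [comulR, map_sumR, map_sumR]
  conv_rhs => rw [← H.sumR_counit a]
  refine H.sumR_congr _ fun v w => ?_
  obtain ⟨l, hl, hθ⟩ := H.exists_tR_πR v
  have h1 : ∀ i, σ.ψ (H.left.π (H.S (v * H.left.t (op (σ.e i))))) =
      σ.ψ (h.toHom (H.left.s l) * σ.e i) := fun i => by
    rw [S_mul_t, H.left.π_s_mul, ← hθ, hd.ψ_apply_s_mul]
  have h2 := congrArg (fun x => H.left.s (g.toHom (H.left.s x)))
    (σ.sum_ψ_mul_e (h.toHom (H.left.s l)))
  simp only [hd.apply_s_density_apply_s, map_sum, hk.s_smul, hk.dual_smul] at h2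
  rw [← hl, ← h2]
  simp only [inclR, map_sum, LinearMap.rTensor_tmul, TensorProduct.lid_tmul, Finset.mul_sum,
    mul_smul_comm]
  exact Finset.sum_congr rfl fun i _ => congrArg (· • _) (h1 i)

theorem comulR_act (hk : H.left.IsOver k) (hd : H.IsInvDensity σ g h) (a : A) :
    H.comulR σ g (H.left.act g a) = (H.left.actLin hk g).rTensor A (H.comulR σ g a) := by
  rw [comulR, comulR, sumR_act (isBalR_inclR hk hd), map_sumR]
  refine H.sumR_congr _ fun x y => ?_
  simp only [inclR, map_sum, LinearMap.rTensor_tmul]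
  refine Finset.sum_congr rfl fun i _ => ?_
  rw [← H.left.act_mul_t]
  rfl

/-- Applying the counit of `Δ` to the first leg of the right coproduct gives `↼ g`. -/
theorem counit_comulR (hk : H.left.IsOver k) (hd : H.IsInvDensity σ g h) (a : A) :
    TensorProduct.lid k A ((H.left.weakCounit hk σ).rTensor A (H.comulR σ g a)) =
      H.left.act g a := by
  conv_rhs => rw [← antipode_counit_comulR hk hd (H.left.act g a), comulR_act hk hd,
    ← LinearMap.comp_apply, ← LinearMap.rTensor_comp]
  congr 3
  exact LinearMap.ext fun b => (hd.ψ_density_act b).symm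

theorem comulR_s_mul (hk : H.left.IsOver k) (hd : H.IsInvDensity σ g h) (l : L) (a : A) :
    H.comulR σ g (H.left.s l * a) = (H.left.s l ⊗ₜ[k] 1) * H.comulR σ g a := by
  rw [comulR, sumR_s_mul (isBalR_inclR hk hd), comulR, const_mul_sumR]
  refine H.sumR_congr _ fun x y => ?_
  simp only [inclR, Finset.mul_sum, Algebra.TensorProduct.tmul_mul_tmul, one_mul, mul_assoc]

/-- The right coproduct is the coproduct `Δ` twisted on its second leg. It follows from mixed
coassociativity, by applying the counit of `Δ` to the middle leg of `(Δ ⊗ id) ∘ Δ_R`. -/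
theorem comulR_eq (hk : H.left.IsOver k) (hd : H.IsInvDensity σ g h) (a : A) :
    H.comulR σ g a = (H.left.actLin hk g).lTensor A (H.left.weakComul hk σ a) := by
  have hD := isBalR_inclR hk hd
  let T : A → A →ₗ[k] A := fun u =>
    LinearMap.mulRight k u ∘ₗ H.left.tLin hk ∘ₗ H.left.πLin hk
  have hT : ∀ u v, T u v = H.left.t (op (H.left.π v)) * u := fun u v => rfl
  -- `F(u, v, w) = t(π(v t(eᵢ))) u ⊗ w s(g(s(fᵢ)))`
  let F : A → A → A → A ⊗[k] A := fun u v w => (T u).rTensor A (H.inclR σ g v w)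
  have hF : ∀ u v w, F u v w = ∑ i,
      (H.left.t (op (H.left.π (v * H.left.t (op (σ.e i))))) * u) ⊗ₜ[k]
        (w * H.left.s (g.toHom (H.left.s (σ.f i)))) := fun u v w => by
    simp only [F, inclR, map_sum, LinearMap.rTensor_tmul, hT]
  have hl : ∀ w, H.left.IsBal fun u v => F u v w := fun w =>
    ⟨fun x x' y => by
      simp only [hF, mul_add, TensorProduct.add_tmul, Finset.sum_add_distrib],
     fun x y y' => by
      simp only [hF, add_mul, map_add, op_add, TensorProduct.add_tmul, Finset.sum_add_distrib],
     fun l x y => by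
      simp only [hF, mul_assoc, H.left.π_s_mul, op_mul, map_mul]⟩
  have hr : ∀ u, H.IsBalR (F u) := fun u => hD.map_hom ((T u).rTensor A).toAddMonoidHom
  have h1 := sum_sumR hl hr a
  have h2 : ∀ x y, (H.left.sum x fun u v => F u v y) = H.inclR σ g x y := by
    intro x y
    simp only [hF]
    rw [LeftBialgebroid.sum_finset_fun]
    refine Finset.sum_congr rfl fun i _ => ?_
    have hb : H.left.IsBal fun u v => H.left.t (op (H.left.π v)) * u :=
      ⟨fun x x' y => mul_add _ _ _, fun x y y' => by rw [map_add, op_add, map_add, add_mul],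
        fun l x y => by rw [H.left.π_s_mul, op_mul, map_mul, mul_assoc]⟩
    conv_rhs => rw [← H.left.sum_t_counit (x * H.left.t (op (σ.e i))),
      LeftBialgebroid.sum_mul_t hb]
    exact (H.left.map_sum ((TensorProduct.mk k A A).flip
      (y * H.left.s (g.toHom (H.left.s (σ.f i))))) x _).symm
  have h3 : ∀ (u : A) (z : A ⊗[k] A), (T u).rTensor A z = ∑ j, (H.left.t (op (σ.e j)) * u) ⊗ₜ[k]
      TensorProduct.lid k A ((H.left.weakCounit hk σ).rTensor A
        ((H.left.s (σ.f j) ⊗ₜ[k] 1) * z)) := by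
    intro u z
    induction z with
    | zero => simp
    | tmul p q =>
      simp only [LinearMap.rTensor_tmul, hT, Algebra.TensorProduct.tmul_mul_tmul, one_mul,
        TensorProduct.lid_tmul, LeftBialgebroid.weakCounit_apply, H.left.π_s_mul]
      rw [← H.left.sum_ψ_t hk σ]
      simp only [Finset.sum_mul, TensorProduct.sum_tmul, smul_mul_assoc, TensorProduct.smul_tmul]
    | add y z hy hz =>
      simp only [map_add, mul_add, TensorProduct.tmul_add, Finset.sum_add_distrib, hy, hz]
  rw [comulR, ← H.sumR_congr a h2, h1, LeftBialgebroid.weakComul_eq, LeftBialgebroid.map_sum]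
  refine H.left.sum_congr _ fun u y => ?_
  rw [← H.map_sumR ((T u).rTensor A)]
  change (T u).rTensor A (H.comulR σ g y) = _
  rw [h3]
  simp only [LeftBialgebroid.incl, map_sum, LinearMap.lTensor_tmul, ← comulR_s_mul hk hd,
    counit_comulR hk hd]
  rfl

end RightComul

/-! ### The weak Hopf algebra axioms for the twisted antipode -/

section WeakHopf

variable [Algebra k A] {H : HopfAlgebroid A L R} {σ : SeparabilityStructure k L}

/-- `S_g(a₁) a₂ = t(π(S(a ↼ g)))` for the coproduct `Δ` and every `g` in the dual ring. -/
theorem antipode_mul_act (hk : H.left.IsOver k) (σ : SeparabilityStructure k L) (g : H.left.Dual)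
    (a : A) : LinearMap.mul' k A ((H.antipode hk ∘ₗ H.left.actLin hk g).rTensor A
      (H.left.weakComul hk σ a)) = H.left.t (op (H.left.π (H.S (H.left.act g a)))) := by
  rw [← sum_antipode', LeftBialgebroid.sum_act H.isBal_antipode', LeftBialgebroid.weakComul_eq,
    LeftBialgebroid.map_sum, LeftBialgebroid.map_sum]
  refine H.left.sum_congr _ fun x y => ?_
  have h1 : ∀ z, (H.antipode hk ∘ₗ H.left.actLin hk g) z = H.S (H.left.act g z) := fun z => rfl
  simp only [LeftBialgebroid.incl, map_sum, LinearMap.rTensor_tmul, LinearMap.mul'_apply, h1,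
    H.left.act_t_mul, S_t_mul]
  conv_rhs => rw [← mul_one (H.S _), ← map_one H.left.s, ← σ.sum_e_mul_f]
  simp only [LeftBialgebroid.s_sum, map_mul, Finset.mul_sum, Finset.sum_mul, mul_assoc]

/-- The axiom for `S_g(a₁) a₂` forces `ψπS(a ↼ g) = ψπ(a)`. -/
theorem ψ_antipode_act_of_antipode_mul (hk : H.left.IsOver k) (g : H.left.Dual)
    (hg : ∀ a : A, LinearMap.mul' k A ((H.antipode hk ∘ₗ H.left.actLin hk g).rTensor A
      (H.left.weakComul hk σ a)) = TensorProduct.rid k A ((H.left.weakCounit hk σ ∘ₗ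
        LinearMap.mulLeft k a).lTensor A (H.left.weakComul hk σ 1))) (a : A) :
    σ.ψ (H.left.π (H.S (H.left.act g a))) = σ.ψ (H.left.π a) := by
  have h1 := congrArg (fun x => σ.ψ (H.left.π x)) (hg a)
  simp only [antipode_mul_act, H.left.π_t, LeftBialgebroid.weakComul_one, map_sum,
    LinearMap.lTensor_tmul, TensorProduct.rid_tmul, LinearMap.comp_apply, hk.π_smul,
    LinearMap.mulLeft_apply, LeftBialgebroid.weakCounit_apply, map_smul, smul_eq_mul] at h1
  rw [h1]
  conv_rhs => rw [← mul_one a, ← map_one H.left.s, ← σ.sum_ψ_e]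
  simp only [Finset.mul_sum, map_sum, hk.s_smul, mul_smul_comm, hk.π_smul, map_smul, smul_eq_mul]
  exact Finset.sum_congr rfl fun _ _ => mul_comm _ _

theorem isWeakHopfAlgebra_of_isInvDensity (hk : H.left.IsOver k) {g h : H.left.Dual}
    (hd : H.IsInvDensity σ g h) : IsWeakHopfAlgebra (H.left.weakComul hk σ)
      (H.left.weakCounit hk σ) (H.antipode hk ∘ₗ H.left.actLin hk g) where
  toIsWeakBialgebra := LeftBialgebroid.isWeakBialgebra hk σ
  mul_antipode a := by
    rw [LinearMap.lTensor_comp, LinearMap.comp_apply, ← comulR_eq hk hd, comulR, map_sumR,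
      map_sumR]
    have h1 : TensorProduct.lid k A ((H.left.weakCounit hk σ ∘ₗ LinearMap.mulRight k a).rTensor A
        (H.left.weakComul hk σ 1)) = H.left.s (H.left.π a) := by
      rw [← H.left.sum_ψ_s hk σ]
      simp only [LeftBialgebroid.weakComul_one, map_sum, LinearMap.rTensor_tmul,
        TensorProduct.lid_tmul, LinearMap.comp_apply, LinearMap.mulRight_apply,
        LeftBialgebroid.weakCounit_apply, H.left.π_t_mul]
    rw [h1, ← sumR_antipode]
    refine H.sumR_congr _ fun x y => ?_
    have h2 : ∀ z, H.antipode hk z = H.S z := fun z => rfl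
    simp only [inclR, map_sum, LinearMap.lTensor_tmul, LinearMap.mul'_apply, h2, S_mul_s]
    conv_rhs => rw [← mul_one x, ← map_one H.left.t, ← op_one, ← hd.sum_θ_mul]
    simp only [LeftBialgebroid.t_sum, op_mul, map_mul, Finset.mul_sum, Finset.sum_mul, mul_assoc]
  antipode_mul a := by
    rw [antipode_mul_act]
    have h1 : ∀ l, σ.ψ (l * H.left.π (H.S (H.left.act g a))) =
        σ.ψ (H.left.π (a * H.left.s l)) := fun l => by
      rw [← H.left.π_s_mul, ← S_mul_t, ← H.left.act_mul_t, hd.ψ_density_act,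
        H.left.π_mul_t_eq_π_mul_s]
    rw [← H.left.sum_ψ_t hk σ]
    simp only [h1, LeftBialgebroid.weakComul_one, map_sum, LinearMap.lTensor_tmul,
      TensorProduct.rid_tmul, LinearMap.comp_apply, LinearMap.mulLeft_apply,
      LeftBialgebroid.weakCounit_apply]
  antipode_mul_antipode a := by
    let T : A →ₗ[k] A := H.left.tLin hk ∘ₗ H.left.πLin hk ∘ₗ H.antipode hk ∘ₗ H.left.actLin hk g
    have hT : ∀ b, T b = H.left.t (op (H.left.π (H.S (H.left.act g b)))) := fun b => rfl
    have h1 : ∀ z : A ⊗[k] A, TensorProduct.map (LinearMap.mul' k A ∘ₗ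
        (H.antipode hk ∘ₗ H.left.actLin hk g).rTensor A) (H.antipode hk ∘ₗ H.left.actLin hk g)
        ((H.left.weakComul hk σ).rTensor A z) =
        TensorProduct.map T (H.antipode hk) ((H.left.actLin hk g).lTensor A z) := by
      intro z
      induction z with
      | zero => simp
      | tmul p q =>
        simp only [LinearMap.rTensor_tmul, LinearMap.lTensor_tmul, TensorProduct.map_tmul, hT,
          LinearMap.comp_apply, antipode_mul_act]
      | add y z hy hz => simp only [map_add, hy, hz]
    have hb : H.IsBalR fun x y => H.left.t (op (H.left.π (H.S x))) * H.S y :=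
      H.isBalR_of (fun x x' y => by simp only [map_add, op_add, add_mul])
        (fun x y y' => by rw [map_add, mul_add])
        (fun l x y => by
          rw [S_mul_t, S_mul_s, H.left.π_s_mul, op_mul, map_mul, mul_assoc])
    rw [h1, ← comulR_eq hk hd, comulR, map_sumR, map_sumR]
    change _ = H.S (H.left.act g a)
    rw [← sumR_counit_antipode, sumR_act hb]
    refine H.sumR_congr _ fun x y => ?_
    have h2 : ∀ z, H.antipode hk z = H.S z := fun z => rfl
    simp only [inclR, map_sum, TensorProduct.map_tmul, LinearMap.mul'_apply, h2, hT, S_mul_s,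
      H.left.act_mul_t, S_mul_t, H.left.π_s_mul]
    conv_rhs => rw [← one_mul (H.left.π _), ← hd.sum_θ_mul]
    simp only [LeftBialgebroid.t_sum, op_mul, map_mul, Finset.sum_mul, mul_assoc]

end WeakHopf

end HopfAlgebroid

/-! ### The twist of an invertible density -/

namespace HopfAlgebroid

variable {k A L R : Type*} [CommRing k] [Ring A] [Ring L] [Ring R] [Algebra k L]
  {H : HopfAlgebroid A L R} {σ : SeparabilityStructure k L} {g h : H.left.Dual}

namespace IsInvDensity

theorem density_act_s_mul (hd : H.IsInvDensity σ g h) (l : L) (a : A) :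
    H.left.act h (H.left.s l * a) = H.left.s (h.toHom (H.left.s l)) * H.left.act h a := by
  rw [← hd.density_act_mul, H.left.act_s]

/-- The tensor product in which the last axiom of a twist is stated. -/
abbrev TwistBal (H : HopfAlgebroid A L R) (h : H.left.Dual) : Type _ :=
  Bal (fun (l : L) (a : A) => a * H.left.s l)
    (fun (l : L) (a : A) => H.left.s (h.toHom (H.left.s l)) * a)

/-- The class of `b ⊗ a`. -/
def tw (H : HopfAlgebroid A L R) (h : H.left.Dual) (b a : A) : TwistBal H h :=
  Bal.mk _ _ (b ⊗ₜ[ℤ] a)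

theorem isBal_tw (H : HopfAlgebroid A L R) (h : H.left.Dual) :
    HopfAlgd.IsBal (fun (l : L) (a : A) => a * H.left.s l)
      (fun (l : L) (a : A) => H.left.s (h.toHom (H.left.s l)) * a) (tw H h) :=
  isBal_mk _ _

theorem isBal_galoisInv (hd : H.IsInvDensity σ g h) (x : A) :
    H.left.IsBal fun u v => tw H h (x * H.S u) (H.left.act h v) :=
  ⟨fun u u' v => by rw [map_add, mul_add, (isBal_tw H h).add_left],
   fun u v v' => by rw [map_add, (isBal_tw H h).add_right],
   fun l u v => by
    rw [S_t_mul, ← mul_assoc, (isBal_tw H h).bal, ← hd.density_act_s_mul]⟩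

theorem isBalR_galoisInv (hd : H.IsInvDensity σ g h) :
    H.IsBalR fun x y => H.left.sum y fun u v => tw H h (x * H.S u) (H.left.act h v) :=
  H.isBalR_of
    (fun x x' y => by
      simp only [add_mul, (isBal_tw H h).add_left]
      exact Bal.sum_add_fun _ _ _)
    (fun x y y' => LeftBialgebroid.sum_add (hd.isBal_galoisInv x) y y')
    (fun l x y => by
      rw [LeftBialgebroid.sum_mul_s (hd.isBal_galoisInv x)]
      simp only [S_mul_s, mul_assoc])

/-- The map `x ⊗ y ↦ x S(y₁) ⊗ (y₂ ↼ h)` is left inverse to the Galois map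
`b ⊗ a ↦ b (a ↼ g)⁽¹⁾ ⊗ (a ↼ g)⁽²⁾`. -/
theorem galoisInv_galois (hd : H.IsInvDensity σ g h) (b a : A) :
    H.sumR (H.left.act g a) (fun x y =>
      H.left.sum y fun u v => tw H h (b * x * H.S u) (H.left.act h v)) = tw H h b a := by
  have h1 := sumR_sum_coassoc (H := H)
    (F := fun u v w => tw H h (b * (u * H.S v)) (H.left.act h w))
    (fun w => H.isBalR_of
      (fun x x' y => by rw [add_mul, mul_add, (isBal_tw H h).add_left])
      (fun x y y' => by rw [map_add, mul_add, mul_add, (isBal_tw H h).add_left])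
      (fun l x y => by simp only [S_mul_s, mul_assoc]))
    (fun x => by simpa only [mul_assoc] using hd.isBal_galoisInv (b * x)) (H.left.act g a)
  simp only [mul_assoc] at h1 ⊢
  rw [← h1]
  have h2 : ∀ x y, (H.sumR x fun u v => tw H h (b * (u * H.S v)) (H.left.act h y)) =
      tw H h b (H.left.act h (H.left.s (H.left.π x) * y)) := by
    intro x y
    rw [hd.density_act_s_mul, ← (isBal_tw H h).bal, ← sumR_antipode, const_mul_sumR]
    exact (H.map_sumR (AddMonoidHom.mk' (fun p => tw H h p (H.left.act h y))
      fun p p' => (isBal_tw H h).add_left p p' _) x _).symm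
  rw [H.left.sum_congr _ h2]
  conv_rhs => rw [← hd.act_act' a, ← H.left.sum_s_counit (H.left.act g a),
    LeftBialgebroid.map_sum]
  exact (H.left.map_sum (AddMonoidHom.mk' (tw H h b) ((isBal_tw H h).add_right b)) _ _).symm

/-- The Galois map sends `(S(a₁) ↼ g) ⊗ a₂` and `S(a₁) ⊗ (a₂ ↼ h)` to the same element. -/
theorem galois_eq (hd : H.IsInvDensity σ g h) {P : Type*} [AddCommGroup P] {f : A → A → P}
    (hf : H.IsBalR f) (a : A) :
    (H.left.sum a fun x y => H.sumR (H.left.act g y) fun u v => f (H.left.act g (H.S x) * u) v) =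
      H.left.sum a fun x y =>
        H.sumR (H.left.act g (H.left.act h y)) fun u v => f (H.S x * u) v := by
  have hf' : ∀ c, H.IsBalR fun u v => f (c * u) v := fun c =>
    ⟨fun x x' y => by rw [mul_add, hf.add_left], fun x y y' => hf.add_right _ _ _,
      fun r x y => by rw [← mul_assoc]; exact hf.bal _ _ _⟩
  -- Both sides reduce to `t(π(S(a⁽¹⁾))) ⊗ a⁽²⁾`, which is fixed by `↼ g` on the first leg.
  have hF : ∀ w, ∃ F : A →+ P, ∀ x, F x = f x w := fun w =>
    ⟨AddMonoidHom.mk' (fun x => f x w) fun x x' => hf.add_left x x' w, fun x => rfl⟩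
  have h2 := sum_sumR (H := H) (F := fun x u v => f (H.left.act g (H.S x * u)) v)
    (fun w => by
      obtain ⟨F, hF⟩ := hF w
      simpa only [← hF, AddMonoidHom.comp_apply] using
        H.isBal_antipode'.map_hom (F.comp (H.left.act g)))
    (fun x => ⟨fun u u' v => by rw [mul_add, map_add, hf.add_left],
      fun u v v' => hf.add_right _ _ _,
      fun r u v => by
        obtain ⟨l, hl⟩ := H.exists_t_eq_sR r
        rw [← mul_assoc, ← hl, H.left.act_mul_t, hl]
        exact hf.bal _ _ _⟩) a
  have h3 := sum_sumR (H := H) (F := fun x u v => f (H.S x * u) v)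
    (fun w => by
      obtain ⟨F, hF⟩ := hF w
      simpa only [← hF] using H.isBal_antipode'.map_hom F)
    (fun x => hf' (H.S x)) a
  have h4 : ∀ x w, (H.left.sum x fun u v => f (H.left.act g (H.S u * v)) w) =
      H.left.sum x fun u v => f (H.S u * v) w := by
    intro x w
    obtain ⟨F, hF⟩ := hF w
    simp only [← hF]
    rw [← H.left.map_sum F, ← H.left.map_sum F, ← H.left.map_sum (H.left.act g), sum_antipode']
    congr 1
    simpa [hd.act_one] using H.left.act_t_mul g (H.left.π (H.S x)) 1
  rw [H.sumR_congr _ h4, h3] at h2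
  simp only [hd.act_act]
  rw [h2]
  refine H.left.sum_congr _ fun x y => ?_
  rw [sumR_act (hf' _)]
  simp only [hd.act_mul]

/-- The inverse of the density is a twist. -/
def twist (hd : H.IsInvDensity σ g h) : H.left.Twist H.S where
  g := g
  inv := h
  mul_inv := hd.mul_inv
  inv_mul := hd.inv_mul
  one_act := hd.act_one
  act_mul := hd.act_mul
  antipode_act a x hx := by
    have h1 := hd.galois_eq hd.isBalR_galoisInv a
    simp only [hd.galoisInv_galois] at h1
    have hb1 : H.left.IsBal fun x y => tw H h (H.left.act g (H.S x)) y :=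
      ⟨fun x x' y => by rw [map_add, map_add, (isBal_tw H h).add_left],
       fun x y y' => (isBal_tw H h).add_right _ _ _,
       fun l x y => by
        rw [S_t_mul, ← hd.act_mul, H.left.act_s, (isBal_tw H h).bal,
          hd.density_apply_s_apply_s]⟩
    have hb2 : H.left.IsBal fun x y => tw H h (H.S x) (H.left.act h y) := by
      simpa only [one_mul] using hd.isBal_galoisInv 1
    rw [LeftBialgebroid.sum_eq_hom hb1 hx, LeftBialgebroid.sum_eq_hom hb2 hx] at h1
    refine Eq.trans ?_ (h1.trans ?_)
    · clear h1 hx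
      induction x with
      | zero => simp
      | tmul p q => rfl
      | add y z hy hz => rw [map_add, map_add, map_add, hy, hz]
    · clear h1 hx
      induction x with
      | zero => simp
      | tmul p q => rfl
      | add y z hy hz => rw [map_add, map_add, map_add, hy, hz]

end IsInvDensity

end HopfAlgebroid

/-! ### Comparison with weak Hopf algebras -/

namespace HopfAlgebroid

variable {k A L R : Type*} [CommRing k] [Ring A] [Ring L] [Ring R] [Algebra k A] [Algebra k L]
  {H : HopfAlgebroid A L R} {σ : SeparabilityStructure k L}

theorem antipode_comp_actLin_one (hk : H.left.IsOver k) :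
    H.antipode hk ∘ₗ H.left.actLin hk (LeftBialgebroid.Dual.one H.left) = H.antipode hk :=
  LinearMap.ext fun a => congrArg H.S (H.left.act_dualOne a)

theorem isWeakHopfAlgebra_antipode_iff (hk : H.left.IsOver k) :
    IsWeakHopfAlgebra (H.left.weakComul hk σ) (H.left.weakCounit hk σ) (H.antipode hk) ↔
      σ.ψ ∘ₗ H.left.πLin hk ∘ₗ H.antipode hk = σ.ψ ∘ₗ H.left.πLin hk := by
  rw [← antipode_comp_actLin_one hk]
  refine ⟨fun hW => LinearMap.ext fun a => ?_, fun hε => ?_⟩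
  · exact ψ_antipode_act_of_antipode_mul hk _ hW.antipode_mul a
  · rw [antipode_comp_actLin_one] at hε
    exact isWeakHopfAlgebra_of_isInvDensity hk (.one (LinearMap.congr_fun hε))

theorem exists_twist_iff (hk : H.left.IsOver k) :
    (∃ τ : H.left.Twist H.S, IsWeakHopfAlgebra (H.left.weakComul hk σ) (H.left.weakCounit hk σ)
        (H.twistedAntipode hk τ)) ↔
      IsConvInvertible (H.left.weakComul hk σ) (H.left.weakCounit hk σ)
        (σ.ψ ∘ₗ H.left.πLin hk ∘ₗ H.antipode hk) := by
  refine ⟨fun ⟨τ, hW⟩ => ?_, fun ⟨χ, h1, h2⟩ => ?_⟩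
  · -- Substituting `a ↼ g⁻¹` for `a` in `ψπS(a ↼ g) = ψπ(a)` gives `ψ ∘ π ∘ S = ψ ∘ g⁻¹`.
    have hS : σ.ψ ∘ₗ H.left.πLin hk ∘ₗ H.antipode hk =
        σ.ψ ∘ₗ LeftBialgebroid.dualLin hk τ.inv := by
      refine LinearMap.ext fun a => ?_
      have h1 := ψ_antipode_act_of_antipode_mul hk τ.g hW.antipode_mul (H.left.act τ.inv a)
      rw [H.left.act_act_of_mul_eq_one τ.inv_mul, H.left.π_act] at h1
      exact h1
    rw [hS]
    exact ⟨_, LeftBialgebroid.convMul_eq_counit hk σ τ.inv_mul,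
      LeftBialgebroid.convMul_eq_counit hk σ τ.mul_inv⟩
  · have hd : H.IsInvDensity σ (LeftBialgebroid.dualOf hk σ χ)
        (LeftBialgebroid.dualOf hk σ (σ.ψ ∘ₗ H.left.πLin hk ∘ₗ H.antipode hk)) :=
      ⟨LeftBialgebroid.ψ_dualOf hk σ _, LeftBialgebroid.dualOf_mul_dualOf hk σ h2,
        LeftBialgebroid.dualOf_mul_dualOf hk σ h1⟩
    exact ⟨hd.twist, isWeakHopfAlgebra_of_isInvDensity hk hd⟩

end HopfAlgebroid

end HopfAlgd

theorem mainTheorem2 {k A L R : Type*} [CommRing k] [Ring A] [Ring L] [Ring R]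
    [Algebra k A] [Algebra k L] (H : HopfAlgd.HopfAlgebroid A L R) (hk : H.left.IsOver k)
    (σ : HopfAlgd.SeparabilityStructure k L) :
    HopfAlgd.IsWeakBialgebra (H.left.weakComul hk σ) (H.left.weakCounit hk σ) ∧
    (HopfAlgd.IsWeakHopfAlgebra (H.left.weakComul hk σ) (H.left.weakCounit hk σ)
        (H.antipode hk) ↔
      σ.ψ ∘ₗ H.left.πLin hk ∘ₗ H.antipode hk = σ.ψ ∘ₗ H.left.πLin hk) ∧
    ((∃ τ : H.left.Twist H.S,
        HopfAlgd.IsWeakHopfAlgebra (H.left.weakComul hk σ) (H.left.weakCounit hk σ)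
          (H.twistedAntipode hk τ)) ↔
      HopfAlgd.IsConvInvertible (H.left.weakComul hk σ) (H.left.weakCounit hk σ)
        (σ.ψ ∘ₗ H.left.πLin hk ∘ₗ H.antipode hk)) := by
  exact ⟨HopfAlgd.LeftBialgebroid.isWeakBialgebra hk σ,
    HopfAlgd.HopfAlgebroid.isWeakHopfAlgebra_antipode_iff hk,
    HopfAlgd.HopfAlgebroid.exists_twist_iff hk⟩
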